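/- Let $m\in\mathbb Z_{\ge 0}$. For $\tau\in\mathbb C$ with $\operatorname{Im}\tau>0$ write $q^x=e^{2\pi i\tau x}$ ($x\in\mathbb C$). For $z_1,z_2,t\in\mathbb C$ put $$\Phi^{[B;m]}(\tau,z_1,z_2,t)=\Phi_1^{[B;m]}(\tau,z_1,z_2,t)-\Phi_1^{[B;m]}(\tau,z_2,z_1,t),$$ $$\Phi_1^{[B;m]}(\tau,z_1,z_2,t)=e^{2\pi i(m+\frac12)t}\sum_{j\in\mathbb Z}(-1)^j\,\frac{e^{\pi i j(2m+1)(z_1+z_2)+\pi i z_1}\,q^{(m+\frac12)j^2+\frac j2}}{1-e^{2\pi i z_1}q^j}.$$ (This is the explicit form, in suitable coordinates of the Cartan subalgebra, of the numerator of the supercharacter of the $\widehat{osp}_{3|2}$-module $L(m\Lambda_0)$.) For $M>0$, $j\in\mathbb R$ let $$\Theta^-_{j,M}(\tau,z)=\sum_{n\in\mathbb Z}(-1)^n e^{2\pi i M z\left(n+\frac{j}{2M}\right)}q^{M\left(n+\frac{j}{2M}\right)^2},$$ and for $j\in\mathbb Z$ let $$R^{[B]}_{j+\frac12,m+\frac12}(\tau,v)=\sum_{\substack{n\in\frac12+\mathbb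 Z\\ n\equiv j+\frac12\ (\mathrm{mod}\ 2m+1)}}(-1)^{n-(j+\frac12)}\Bigl\{\operatorname{sgn}(n)-E\Bigl(\bigl(n+(2m+1)\tfrac{\operatorname{Im}v}{\operatorname{Im}\tau}\bigr)\sqrt{\tfrac{\operatorname{Im}\tau}{m+1/2}}\Bigr)\Bigr\}e^{-\frac{\pi i n^2\tau}{2m+1}-2\pi i n v},$$ where $E(x)=2\int_0^x e^{-\pi u^2}\,du$. Put $$\Phi^{[B;m]}_{add}(\tau,z_1,z_2,t)=\tfrac12 e^{2\pi i(m+\frac12)t}\sum_{j=0}^{2m}R^{[B]}_{j+\frac12,m+\frac12}\bigl(\tau,\tfrac{z_1-z_2}2\bigr)\bigl(\Theta^-_{j+\frac12,m+\frac12}+\Theta^-_{-(j+\frac12),m+\frac12}\bigr)(\tau,z_1+z_2)$$ and $\widetilde\Phi^{[B;m]}=\Phi^{[B;m]}+\Phi^{[B;m]}_{add}$. **Theorem.** Let $\operatorname{Im}\tau>0$. The series for $\Phi_1^{[B;m]}$ converges absolutely whenever $z_1\notin\mathbb Z+\tau\mathbb Z$; the series for $\Theta^-_{j+\frac12,m+\frac12}(\tau,z)$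 and $R^{[B]}_{j+\frac12,m+\frac12}(\tau,v)$, $j\in\mathbb Z$, converge absolutely for all $z,v\in\mathbb C$. For all $z_1,z_2\in\mathbb C\setminus(\mathbb Z+\tau\mathbb Z)$ (that is, away from the poles) and all $t\in\mathbb C$: 1. $\widetilde\Phi^{[B;m]}\bigl(-\frac1\tau,\frac{z_1}\tau,\frac{z_2}\tau,t-\frac{z_1z_2}\tau\bigr)=\tau\,\widetilde\Phi^{[B;m]}(\tau,z_1,z_2,t)$. 2. $\widetilde\Phi^{[B;m]}(\tau+1,z_1,z_2,t)=\widetilde\Phi^{[B;m]}(\tau,z_1,z_2,t)$. 3. For $a,b\in\mathbb Z$ with $a+b\in2\mathbb Z$: $\widetilde\Phi^{[B;m]}(\tau,z_1+a,z_2+b,t)=(-1)^a\,\widetilde\Phi^{[B;m]}(\tau,z_1,z_2,t)$ and $$\widetilde\Phi^{[B;m]}(\tau,z_1+a\tau,z_2+b\tau,t)=(-1)^a e^{-2\pi i(m+\frac12)(az_2+bz_1)}q^{-(m+\frac12)ab}\,\widetilde\Phi^{[B;m]}(\tau,z_1,z_2,t).$$ 4. $\widetilde\Phi^{[B;m]}(\tau,z_2,z_1,t)=-\widetilde\Phi^{[B;m]}(\tau,z_1,z_2,t)$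 and $\widetilde\Phi^{[B;m]}(\tau,-z_1,-z_2,t)=-\widetilde\Phi^{[B;m]}(\tau,z_1,z_2,t)$. Equivalently, let $\varphi^{[B;m]}(\tau,u,v,t)=\Phi^{[B;m]}(\tau,u+v,u-v,t)$, $$\varphi^{[B;m]}_{add}(\tau,u,v,t)=\tfrac12 e^{2\pi i(m+\frac12)t}\sum_{j=0}^{2m}R^{[B]}_{j+\frac12,m+\frac12}(\tau,v)\bigl(\Theta^-_{j+\frac12,m+\frac12}+\Theta^-_{-(j+\frac12),m+\frac12}\bigr)(\tau,2u)$$ and $\widetilde\varphi^{[B;m]}=\varphi^{[B;m]}+\varphi^{[B;m]}_{add}$. Then $\widetilde\Phi^{[B;m]}(\tau,z_1,z_2,t)=\widetilde\varphi^{[B;m]}\bigl(\tau,\frac{z_1+z_2}2,\frac{z_1-z_2}2,t\bigr)$ for all $z_1,z_2,t\in\mathbb C$, and whenever $u\pm v\notin\mathbb Z+\tau\mathbb Z$ and $t\in\mathbb C$: 1. $\widetilde\varphi^{[B;m]}\bigl(-\frac1\tau,\frac u\tau,\frac v\tau,t+\frac{v^2-u^2}\tau\bigr)=\tau\,\widetilde\varphi^{[B;m]}(\tau,u,v,t)$.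 2. $\widetilde\varphi^{[B;m]}(\tau+1,u,v,t)=\widetilde\varphi^{[B;m]}(\tau,u,v,t)$. 3. For all $a,b\in\mathbb Z$: $\widetilde\varphi^{[B;m]}(\tau,u+a,v+b,t)=(-1)^{a+b}\,\widetilde\varphi^{[B;m]}(\tau,u,v,t)$ and $$\widetilde\varphi^{[B;m]}(\tau,u+a\tau,v+b\tau,t)=(-1)^{a+b}e^{2\pi i(2m+1)(bv-au)}q^{(m+\frac12)(b^2-a^2)}\,\widetilde\varphi^{[B;m]}(\tau,u,v,t).$$ 4. $\widetilde\varphi^{[B;m]}(\tau,u,-v,t)=-\widetilde\varphi^{[B;m]}(\tau,u,v,t)$ and $\widetilde\varphi^{[B;m]}(\tau,-u,v,t)=\widetilde\varphi^{[B;m]}(\tau,u,v,t)$. -/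

import Mathlib

namespace Osp32

open Complex

noncomputable section

/-- `q ^ x` for `q = exp (2 π i τ)`, with the branch fixed by `τ`. -/
def qPow (τ x : ℂ) : ℂ := exp (2 * Real.pi * I * τ * x)

/-- The `j`-th term of the series defining `Φ₁^{[B;m]} (τ, z₁, z₂, 0)`. -/
def numTerm (m : ℕ) (τ z₁ z₂ : ℂ) (j : ℤ) : ℂ :=
  (-1) ^ j *
    (exp (Real.pi * I * j * (2 * m + 1) * (z₁ + z₂) + Real.pi * I * z₁) *
        qPow τ ((m + 1 / 2) * j ^ 2 + j / 2)) /
      (1 - exp (2 * Real.pi * I * z₁) * qPow τ j)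

/-- `Φ₁^{[B;m]} (τ, z₁, z₂, t)`. -/
def num₁ (m : ℕ) (τ z₁ z₂ t : ℂ) : ℂ :=
  exp (2 * Real.pi * I * (m + 1 / 2) * t) * ∑' j : ℤ, numTerm m τ z₁ z₂ j

/-- `Φ^{[B;m]} (τ, z₁, z₂, t)`: the numerator of the supercharacter of the affine `osp(3|2)`-module
`L(m Λ₀)`, written in the coordinates
`h = 2 π i (-τ Λ₀ - z₁ (α₁ + 2 α₂) - z₂ α₁ + t δ)`. -/
def num (m : ℕ) (τ z₁ z₂ t : ℂ) : ℂ :=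
  num₁ m τ z₁ z₂ t - num₁ m τ z₂ z₁ t

/-- The `n`-th term of the series defining `Θ⁻_{j,M} (τ, z)`. -/
def thetaMinusTerm (j M : ℝ) (τ z : ℂ) (n : ℤ) : ℂ :=
  (-1) ^ n * exp (2 * Real.pi * I * M * z * (n + j / (2 * M))) *
    qPow τ (M * (n + j / (2 * M)) ^ 2)

/-- The alternating theta function `Θ⁻_{j,M} (τ, z)` of degree `M`. -/
def thetaMinus (j M : ℝ) (τ z : ℂ) : ℂ :=
  ∑' n : ℤ, thetaMinusTerm j M τ z n

/-- `E (x) = 2 ∫₀ˣ exp (-π u²) du`. -/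
def erfE (x : ℝ) : ℝ := 2 * ∫ u in (0 : ℝ)..x, Real.exp (-Real.pi * u ^ 2)

/-- The `n`-th summand of `R^{[B]}_{j+1/2,m+1/2} (τ, v)`, for `n = (j + 1/2) + (2m+1) k`; as `k` runs
over `ℤ`, this `n` runs over the half-integers congruent to `j + 1/2` modulo `2m+1`. -/
def zwegersTerm (m : ℕ) (j : ℤ) (τ v : ℂ) (k : ℤ) : ℂ :=
  let n : ℝ := (j + 1 / 2) + (2 * m + 1) * k
  (-1) ^ ((2 * (m : ℤ) + 1) * k) *
    ((SignType.sign n : ℝ) -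
      erfE ((n + (2 * m + 1) * (v.im / τ.im)) * Real.sqrt (τ.im / (m + 1 / 2))) : ℝ) *
    exp (-(Real.pi * I * n ^ 2 * τ) / (2 * m + 1) - 2 * Real.pi * I * n * v)

/-- The Zwegers-type function `R^{[B]}_{j+1/2,m+1/2} (τ, v)`. -/
def zwegersR (m : ℕ) (j : ℤ) (τ v : ℂ) : ℂ :=
  ∑' k : ℤ, zwegersTerm m j τ v k

/-- The additional term `Φ_add^{[B;m]} (τ, z₁, z₂, t)`. -/
def numAdd (m : ℕ) (τ z₁ z₂ t : ℂ) : ℂ :=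
  1 / 2 * exp (2 * Real.pi * I * (m + 1 / 2) * t) *
    ∑ j ∈ Finset.range (2 * m + 1),
      zwegersR m j τ ((z₁ - z₂) / 2) *
        (thetaMinus (j + 1 / 2) (m + 1 / 2) τ (z₁ + z₂) +
          thetaMinus (-(j + 1 / 2)) (m + 1 / 2) τ (z₁ + z₂))

/-- The modified numerator `Φ~^{[B;m]} = Φ^{[B;m]} + Φ_add^{[B;m]}`. -/
def numMod (m : ℕ) (τ z₁ z₂ t : ℂ) : ℂ :=
  num m τ z₁ z₂ t + numAdd m τ z₁ z₂ t

/-- `φ^{[B;m]} (τ, u, v, t) = Φ^{[B;m]} (τ, z₁, z₂, t)` with `z₁ = u + v`, `z₂ = u - v`. -/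
def phi (m : ℕ) (τ u v t : ℂ) : ℂ :=
  num m τ (u + v) (u - v) t

/-- The additional term `φ_add^{[B;m]} (τ, u, v, t)`. -/
def phiAdd (m : ℕ) (τ u v t : ℂ) : ℂ :=
  1 / 2 * exp (2 * Real.pi * I * (m + 1 / 2) * t) *
    ∑ j ∈ Finset.range (2 * m + 1),
      zwegersR m j τ v *
        (thetaMinus (j + 1 / 2) (m + 1 / 2) τ (2 * u) +
          thetaMinus (-(j + 1 / 2)) (m + 1 / 2) τ (2 * u))

/-- `φ~^{[B;m]} = φ^{[B;m]} + φ_add^{[B;m]}`. -/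
def phiMod (m : ℕ) (τ u v t : ℂ) : ℂ :=
  phi m τ u v t + phiAdd m τ u v t

/-- `z` lies outside the lattice `ℤ + τ ℤ`. The poles of `Φ^{[B;m]}` are the points at which `z₁` or
`z₂` lies in this lattice. -/
def OffLattice (τ z : ℂ) : Prop := ∀ n k : ℤ, z ≠ n + k * τ

end

end Osp32

namespace Osp32

open Complex

/-! ### Gaussian summability -/

/-! The non-holomorphic correction turns each Appell-Lerch series into a Gaussian sum over a
translate of the lattice `ℤ + τ ℤ`, and on such a sum every transformation law is a relabelling of
lattice points.

Put `w = u + v + a τ` and `p = (2m+1) Im v / Im τ`. The `a`-th Appell-Lerch term is an automorphy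
factor times `e^{πiw} / (1 - e^{2πiw})`. Multiplying out `zwegersR * thetaMinus` and grouping by the
same `a` gives the same factor times a series in `sgn(n) - E((n+p)κ)` over half-integers `n`
(`zwegersTerm_mul_thetaMinusTerm`). By `tsum_gaussTerm_div_eq`, the geometric term plus half the
error series equals `-1/(2πi)` times an alternating Gaussian sum over `b` with simple poles `1/(w +
b)`. Summing over `a` yields `latticeSum`.

That Poisson formula is proved by varying the real parameter `p`. Differentiation removes the pole,
and the derivatives of the two sides agree by ordinary Poisson summation, so their difference is
constant in `p`. Yet `p ↦ p + 1` multiplies the difference by `e^{2πiw} ≠ 1`, so it vanishes.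

The modified numerator is the part of `latticeSum` odd in `v` (`phiMod_eq_latticeSum`). The maps S,
T, the elliptic translations and negation permute the pairs `(a, b)`, and the exponents then match
up to explicit factors and integer multiples of `2πi`. -/

theorem summable_exp_neg_sq_add_abs {δ : ℝ} (hδ : 0 < δ) (L : ℝ) :
    Summable fun n : ℤ => Real.exp (-δ * n ^ 2 + L * |(n : ℝ)|) := by
  have h := summable_pow_mul_jacobiTheta₂_term_bound (L / (2 * Real.pi))
    (div_pos hδ Real.pi_pos) 0
  refine h.congr fun n => ?_
  rw [pow_zero, one_mul, Int.cast_abs]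
  congr 1
  field_simp
  ring

theorem summable_of_norm_le_exp {f : ℤ → ℂ} {δ : ℝ} (hδ : 0 < δ) (L K : ℝ)
    (h : ∀ n, ‖f n‖ ≤ K * Real.exp (-δ * n ^ 2 + L * n)) : Summable f := by
  refine Summable.of_norm_bounded ((summable_exp_neg_sq_add_abs hδ |L|).mul_left |K|)
    fun n => (h n).trans ?_
  have h1 : L * n ≤ |L| * |(n : ℝ)| := by rw [← abs_mul]; exact le_abs_self _
  gcongr
  exact le_abs_self K

theorem summable_exp_neg_sq_add_abs_prod {δ : ℝ} (hδ : 0 < δ) (L : ℝ) :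
    Summable fun p : ℤ × ℤ =>
      Real.exp (-δ * ((p.1 : ℝ) ^ 2 + (p.2 : ℝ) ^ 2) + L * (|(p.1 : ℝ)| + |(p.2 : ℝ)|)) := by
  have h := summable_exp_neg_sq_add_abs hδ L
  refine (h.mul_of_nonneg h (fun _ => (Real.exp_pos _).le) fun _ => (Real.exp_pos _).le).congr
    fun p => ?_
  rw [← Real.exp_add]
  ring_nf

/-! ### The error function -/

theorem hasDerivAt_erfE (x : ℝ) : HasDerivAt erfE (2 * Real.exp (-Real.pi * x ^ 2)) x := by
  have hc : Continuous fun u : ℝ => Real.exp (-Real.pi * u ^ 2) := by fun_prop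
  exact (intervalIntegral.integral_hasDerivAt_right (hc.intervalIntegrable _ _)
    hc.stronglyMeasurable.stronglyMeasurableAtFilter hc.continuousAt).const_mul 2

theorem erfE_neg (x : ℝ) : erfE (-x) = -erfE x := by
  have h := intervalIntegral.integral_comp_neg (a := 0) (b := x)
    (fun u : ℝ => Real.exp (-Real.pi * u ^ 2))
  simp only [neg_sq, neg_zero] at h
  rw [erfE, erfE, h, intervalIntegral.integral_symm]
  ring

theorem one_sub_erfE_eq (x : ℝ) :
    1 - erfE x = 2 * ∫ u in Set.Ioi x, Real.exp (-Real.pi * u ^ 2) := by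
  have hi : MeasureTheory.Integrable fun u : ℝ => Real.exp (-Real.pi * u ^ 2) :=
    integrable_exp_neg_mul_sq Real.pi_pos
  have h := intervalIntegral.integral_Ioi_sub_Ioi' (a := 0) (b := x)
    (hi.integrableOn (s := Set.Ioi 0)) (hi.integrableOn (s := Set.Ioi x))
  have h0 := integral_gaussian_Ioi Real.pi
  rw [div_self Real.pi_ne_zero, Real.sqrt_one] at h0
  rw [erfE, ← h, h0]
  ring

theorem one_sub_erfE_nonneg (x : ℝ) : 0 ≤ 1 - erfE x := by
  rw [one_sub_erfE_eq]
  exact mul_nonneg zero_le_two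
    (MeasureTheory.setIntegral_nonneg measurableSet_Ioi fun _ _ => (Real.exp_pos _).le)

/-- Translating the tail to start at `0` and using `(u + x)² ≥ u² + x²` for `u, x ≥ 0` leaves a half
Gaussian integral, which is `1/2`. -/
theorem one_sub_erfE_le {x : ℝ} (hx : 0 ≤ x) : 1 - erfE x ≤ Real.exp (-Real.pi * x ^ 2) := by
  have hi : MeasureTheory.Integrable fun u : ℝ => Real.exp (-Real.pi * u ^ 2) :=
    integrable_exp_neg_mul_sq Real.pi_pos
  have h0 := integral_gaussian_Ioi Real.pi
  rw [div_self Real.pi_ne_zero, Real.sqrt_one] at h0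
  have hs : ∫ u in Set.Ioi x, Real.exp (-Real.pi * u ^ 2) =
      ∫ u in Set.Ioi 0, Real.exp (-Real.pi * (u + x) ^ 2) := by
    have h := (MeasureTheory.measurePreserving_add_right MeasureTheory.volume x
      ).setIntegral_preimage_emb (measurableEmbedding_addRight x)
      (fun u : ℝ => Real.exp (-Real.pi * u ^ 2)) (Set.Ioi x)
    simpa using h.symm
  have hle : ∫ u in Set.Ioi 0, Real.exp (-Real.pi * (u + x) ^ 2) ≤
      ∫ u in Set.Ioi 0, Real.exp (-Real.pi * x ^ 2) * Real.exp (-Real.pi * u ^ 2) := by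
    refine MeasureTheory.setIntegral_mono_on (hi.comp_add_right x).integrableOn
      (hi.const_mul _).integrableOn measurableSet_Ioi fun u hu => ?_
    rw [← Real.exp_add]
    have : 0 ≤ Real.pi * (u * x) := mul_nonneg Real.pi_pos.le (mul_nonneg (le_of_lt hu) hx)
    gcongr
    nlinarith
  rw [MeasureTheory.integral_const_mul, h0] at hle
  rw [one_sub_erfE_eq, hs]
  linarith

theorem abs_erfE_le_one (x : ℝ) : |erfE x| ≤ 1 := by
  have h1 := one_sub_erfE_nonneg x
  have h2 := one_sub_erfE_nonneg (-x)
  rw [erfE_neg] at h2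
  exact abs_le.2 ⟨by linarith, by linarith⟩

/-- If `n² + 2np ≤ 0`, the exponential is at least `1` and the trivial bound `2` suffices. Otherwise
`n + p` has the sign of `n`, so the Gaussian tail bound applies, and `(n + p)² ≥ n² + 2np`. -/
theorem abs_sign_sub_erfE_le (n p : ℝ) {κ : ℝ} (hκ : 0 < κ) :
    |((SignType.sign n : SignType) : ℝ) - erfE ((n + p) * κ)| ≤
      2 * Real.exp (-(Real.pi * κ ^ 2) * (n ^ 2 + 2 * n * p)) := by
  by_cases hc : n ^ 2 + 2 * n * p ≤ 0
  · have h1 : |((SignType.sign n : SignType) : ℝ)| ≤ 1 := by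
      rcases lt_trichotomy n 0 with h | h | h <;> simp [h]
    have h2 := abs_erfE_le_one ((n + p) * κ)
    have h3 : 1 ≤ Real.exp (-(Real.pi * κ ^ 2) * (n ^ 2 + 2 * n * p)) := by
      apply Real.one_le_exp
      have : 0 ≤ Real.pi * κ ^ 2 := by positivity
      nlinarith
    linarith [abs_sub ((SignType.sign n : SignType) : ℝ) (erfE ((n + p) * κ))]
  · push Not at hc
    have key : ∀ x : ℝ, 0 ≤ x → |1 - erfE x| ≤ Real.exp (-Real.pi * x ^ 2) := fun x hx => by
      rw [abs_of_nonneg (one_sub_erfE_nonneg x)]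
      exact one_sub_erfE_le hx
    have hle : Real.exp (-Real.pi * ((n + p) * κ) ^ 2) ≤
        2 * Real.exp (-(Real.pi * κ ^ 2) * (n ^ 2 + 2 * n * p)) := by
      have h1 : Real.exp (-Real.pi * ((n + p) * κ) ^ 2) ≤
          Real.exp (-(Real.pi * κ ^ 2) * (n ^ 2 + 2 * n * p)) := by
        apply Real.exp_le_exp.2
        have : 0 ≤ Real.pi * κ ^ 2 * p ^ 2 := by positivity
        nlinarith
      linarith [Real.exp_pos (-(Real.pi * κ ^ 2) * (n ^ 2 + 2 * n * p))]
    refine le_trans ?_ hle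
    rcases lt_trichotomy n 0 with h | h | h
    · have hx : 0 ≤ -((n + p) * κ) := by
        have : n + p ≤ 0 := by nlinarith
        nlinarith
      have := key _ hx
      rw [erfE_neg, neg_sq] at this
      rw [sign_neg h, ← abs_neg]
      have e : -(((-1 : SignType) : ℝ) - erfE ((n + p) * κ)) = 1 - -erfE ((n + p) * κ) := by
        rw [SignType.coe_neg_one]
        ring
      rwa [e]
    · simp [h] at hc
    · have hx : 0 ≤ (n + p) * κ := by
        have : 0 ≤ n + p := by nlinarith
        positivity
      rw [sign_pos h]
      simpa using key _ hx

/-! ### A Poisson summation formula for Gaussians with a simple pole -/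

/-- The summand `(-1) ^ b exp (-π (w + b)² / κ² + 2 π i p (w + b))` of an alternating Gaussian
series. -/
noncomputable def gaussTerm (κ : ℝ) (w : ℂ) (p : ℝ) (b : ℤ) : ℂ :=
  (-1) ^ b * exp (-Real.pi / κ ^ 2 * (w + b) ^ 2 + 2 * Real.pi * I * p * (w + b))

/-- The summand of the Fourier dual series of `gaussTerm`, over half-integers `r + 1 / 2`. -/
noncomputable def dualTerm (κ : ℝ) (w : ℂ) (p : ℝ) (r : ℤ) : ℂ :=
  κ * exp (-Real.pi * κ ^ 2 * (r + 1 / 2 + p) ^ 2 - 2 * Real.pi * I * (r + 1 / 2) * w)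

/-- The summand of the Fourier dual series of `gaussTerm κ w p b / (w + b)`. -/
noncomputable def errTerm (κ : ℝ) (w : ℂ) (p : ℝ) (r : ℤ) : ℂ :=
  ((((SignType.sign (r + 1 / 2 : ℝ) : SignType) : ℝ) - erfE ((r + 1 / 2 + p) * κ) : ℝ) : ℂ) *
    exp (-2 * Real.pi * I * (r + 1 / 2) * w)

theorem neg_one_zpow_eq_exp (n : ℤ) : (-1 : ℂ) ^ n = exp (Real.pi * I * n) := by
  rw [← exp_pi_mul_I, ← exp_int_mul]
  ring_nf

theorem exp_two_pi_I_mul_intCast (n : ℤ) : exp (2 * Real.pi * I * n) = 1 := by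
  rw [mul_comm]
  exact exp_int_mul_two_pi_mul_I n

theorem norm_neg_one_zpow (n : ℤ) : ‖(-1 : ℂ) ^ n‖ = 1 := by simp

/-- This is theta inversion. The alternating sign `(-1) ^ b = e^{πib}` shifts the dual variable by
one half, which is why the dual series runs over half-integers. -/
theorem tsum_gaussTerm {κ : ℝ} (hκ : 0 < κ) (w : ℂ) (p : ℝ) :
    ∑' b, gaussTerm κ w p b = ∑' r, dualTerm κ w p r := by
  have hκ' : (κ : ℂ) ≠ 0 := ofReal_ne_zero.2 hκ.ne'
  have ha : 0 < ((κ : ℂ) ^ 2).re := by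
    rw [← ofReal_pow, ofReal_re]
    positivity
  have h := tsum_exp_neg_quadratic ha (-(κ : ℂ) ^ 2 * (1 / 2 + p) - I * w)
  rw [one_div 2, sq_cpow_two_inv (by simpa using hκ)] at h
  -- `κ * A` is the dual term at `r = 0`. Factoring `A` out brings both series to the shape of
  -- `tsum_exp_neg_quadratic`.
  set A : ℂ := exp (-Real.pi * κ ^ 2 * (1 / 2 + p) ^ 2 - Real.pi * I * w)
  have h1 : ∀ r : ℤ, dualTerm κ w p r = κ * A * exp (-Real.pi * κ ^ 2 * r ^ 2 +
      2 * Real.pi * (-(κ : ℂ) ^ 2 * (2⁻¹ + p) - I * w) * r) := fun r => by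
    rw [dualTerm, mul_assoc (κ : ℂ) A, ← exp_add]
    ring_nf
  have h2 : ∀ b : ℤ, gaussTerm κ w p b = A * exp (-Real.pi / κ ^ 2 *
      (b + I * (-(κ : ℂ) ^ 2 * (2⁻¹ + p) - I * w)) ^ 2) := fun b => by
    rw [gaussTerm, ← exp_add, neg_one_zpow_eq_exp, ← exp_add]
    congr 1
    field_simp
    ring_nf
    simp only [I_sq, I_pow_four, show (I : ℂ) ^ 3 = -I by rw [pow_succ, I_sq]; ring]
    ring
  rw [tsum_congr h1, tsum_congr h2, tsum_mul_left, tsum_mul_left, h]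
  generalize ∑' n : ℤ, exp (-Real.pi / (κ : ℂ) ^ 2 *
    (n + I * (-(κ : ℂ) ^ 2 * (2⁻¹ + p) - I * w)) ^ 2) = S
  field_simp

theorem norm_gaussTerm_le (κ : ℝ) (w : ℂ) {p P : ℝ} (hp : |p| ≤ P) (b : ℤ) :
    ‖gaussTerm κ w p b‖ ≤
      Real.exp (Real.pi / κ ^ 2 * w.im ^ 2 - Real.pi / κ ^ 2 * w.re ^ 2 +
        2 * Real.pi * P * |w.im|) *
      Real.exp (-(Real.pi / κ ^ 2) * b ^ 2 + -(2 * Real.pi / κ ^ 2 * w.re) * b) := by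
  rw [gaussTerm, norm_mul, norm_neg_one_zpow, one_mul, norm_exp, ← Real.exp_add]
  apply Real.exp_le_exp.2
  have e : (-Real.pi / κ ^ 2 * (w + b) ^ 2 + 2 * Real.pi * I * p * (w + b) : ℂ).re =
      Real.pi / κ ^ 2 * w.im ^ 2 - Real.pi / κ ^ 2 * (w.re + b) ^ 2 - 2 * Real.pi * p * w.im := by
    have h1 : (-Real.pi / κ ^ 2 : ℂ) = ((-Real.pi / κ ^ 2 : ℝ) : ℂ) := by push_cast; ring
    have h2 : (2 * Real.pi * I * p * (w + b) : ℂ) = ((2 * Real.pi * p : ℝ) : ℂ) * (I * (w + b)) := by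
      push_cast; ring
    rw [h1, h2, add_re, re_ofReal_mul, re_ofReal_mul]
    simp [pow_two]
    ring
  rw [e]
  have h3 : -(p * w.im) ≤ P * |w.im| := by
    refine (neg_le_abs _).trans ?_
    rw [abs_mul]
    gcongr
  have h4 : 0 < Real.pi := Real.pi_pos
  have h5 : Real.pi * (-(p * w.im)) ≤ Real.pi * (P * |w.im|) := by gcongr
  have h6 : Real.pi / κ ^ 2 * (w.re + b) ^ 2 = Real.pi / κ ^ 2 * w.re ^ 2 +
    Real.pi / κ ^ 2 * b ^ 2 + 2 * Real.pi / κ ^ 2 * w.re * b := by ring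
  linarith

/-- Half of the Gaussian decay is spent on absorbing the cross term between `r` and `p`, so that the
majorant depends on `P` only and allows termwise differentiation in `p`. -/
theorem norm_dualTerm_le {κ : ℝ} (hκ : 0 < κ) (w : ℂ) {p P : ℝ} (hp : |p| ≤ P) (r : ℤ) :
    ‖dualTerm κ w p r‖ ≤
      κ * Real.exp (Real.pi * κ ^ 2 * P ^ 2 + Real.pi * w.im) *
      Real.exp (-(Real.pi * κ ^ 2 / 2) * r ^ 2 +
        (2 * Real.pi * w.im - Real.pi * κ ^ 2 / 2) * r) := by
  rw [dualTerm, norm_mul, norm_real, Real.norm_of_nonneg hκ.le, norm_exp, mul_assoc κ (Real.exp _),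
    ← Real.exp_add]
  gcongr
  have e : (-Real.pi * κ ^ 2 * (r + 1 / 2 + p) ^ 2 - 2 * Real.pi * I * (r + 1 / 2) * w : ℂ) =
      ((-Real.pi * κ ^ 2 * (r + 1 / 2 + p) ^ 2 : ℝ) : ℂ) +
      ((-2 * Real.pi * (r + 1 / 2) : ℝ) : ℂ) * (I * w) := by
    push_cast
    ring
  rw [e, add_re, ofReal_re, re_ofReal_mul, I_mul_re]
  have h1 : p ^ 2 ≤ P ^ 2 := sq_le_sq' (by linarith [neg_abs_le p]) ((le_abs_self p).trans hp)
  have h2 : (r : ℝ) ^ 2 / 2 + r / 2 - P ^ 2 ≤ (r + 1 / 2 + p) ^ 2 := by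
    nlinarith [sq_nonneg ((r : ℝ) + 1 / 2 + 2 * p)]
  have h3 : 0 ≤ Real.pi * κ ^ 2 := by positivity
  nlinarith [mul_le_mul_of_nonneg_left h2 h3]

theorem norm_errTerm_le {κ : ℝ} (hκ : 0 < κ) (w : ℂ) (p : ℝ) (r : ℤ) :
    ‖errTerm κ w p r‖ ≤
      2 * Real.exp (Real.pi * w.im - Real.pi * κ ^ 2 * (1 / 4 + p)) *
      Real.exp (-(Real.pi * κ ^ 2) * r ^ 2 +
        (2 * Real.pi * w.im - Real.pi * κ ^ 2 * (1 + 2 * p)) * r) := by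
  have e : (-2 * Real.pi * I * (r + 1 / 2) * w : ℂ) =
      ((-2 * Real.pi * (r + 1 / 2) : ℝ) : ℂ) * (I * w) := by
    push_cast
    ring
  rw [errTerm, norm_mul, norm_real, Real.norm_eq_abs, norm_exp, e, re_ofReal_mul, I_mul_re]
  refine (mul_le_mul_of_nonneg_right (abs_sign_sub_erfE_le _ p hκ) (Real.exp_pos _).le).trans ?_
  rw [mul_assoc 2 (Real.exp _), mul_assoc 2 (Real.exp _), ← Real.exp_add, ← Real.exp_add]
  apply le_of_eq
  ring_nf

theorem summable_gaussTerm {κ : ℝ} (hκ : 0 < κ) (w : ℂ) (p : ℝ) : Summable (gaussTerm κ w p) :=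
  summable_of_norm_le_exp (by positivity) _ _ (norm_gaussTerm_le κ w le_rfl)

theorem summable_errTerm {κ : ℝ} (hκ : 0 < κ) (w : ℂ) (p : ℝ) : Summable (errTerm κ w p) :=
  summable_of_norm_le_exp (by positivity) _ _ (norm_errTerm_le hκ w p)

theorem summable_gaussTerm_div {κ : ℝ} (hκ : 0 < κ) (w : ℂ) (p : ℝ) :
    Summable fun b : ℤ => gaussTerm κ w p b / (w + b) := by
  refine Summable.of_norm_bounded_eventually (summable_gaussTerm hκ w p).norm ?_
  have ht := tendsto_norm_comp_cofinite_atTop_of_isClosedEmbedding Int.isClosedEmbedding_coe_real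
  filter_upwards [ht.eventually_ge_atTop (1 + ‖w‖)] with b hb
  have h1 : 1 ≤ ‖w + b‖ := by
    have h2 := norm_sub_le (w + b) w
    rw [add_sub_cancel_left, norm_intCast] at h2
    simp only [Function.comp, Real.norm_eq_abs] at hb
    linarith
  rw [norm_div]
  exact div_le_self (norm_nonneg _) h1

theorem hasDerivAt_gaussTerm_div (κ : ℝ) {w : ℂ} (p : ℝ) {b : ℤ} (hw : w + b ≠ 0) :
    HasDerivAt (fun p => gaussTerm κ w p b / (w + b)) (2 * Real.pi * I * gaussTerm κ w p b) p := by
  have h1 : HasDerivAt (fun p : ℝ => (-Real.pi / κ ^ 2 * (w + b) ^ 2 +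
      2 * Real.pi * I * p * (w + b) : ℂ)) (2 * Real.pi * I * 1 * (w + b)) p :=
    (((hasDerivAt_id p).ofReal_comp.const_mul _).mul_const _).const_add _
  refine ((h1.cexp.const_mul ((-1 : ℂ) ^ b)).div_const (w + b)).congr_deriv ?_
  rw [gaussTerm]
  field_simp

theorem hasDerivAt_errTerm (κ : ℝ) (w : ℂ) (p : ℝ) (r : ℤ) :
    HasDerivAt (fun p => errTerm κ w p r) (-2 * dualTerm κ w p r) p := by
  have h1 : HasDerivAt (fun p : ℝ => (r + 1 / 2 + p) * κ) (1 * κ) p :=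
    ((hasDerivAt_id p).const_add _).mul_const _
  have h2 := (((hasDerivAt_erfE _).comp p h1).const_sub
    (((SignType.sign (r + 1 / 2 : ℝ) : SignType) : ℝ))).ofReal_comp
  refine (h2.mul_const (exp (-2 * Real.pi * I * (r + 1 / 2) * w))).congr_deriv ?_
  rw [dualTerm, sub_eq_add_neg, exp_add]
  push_cast
  ring_nf

/-- Replacing `r` by `r - 1` undoes the shift of `p` inside `erfE`. The signs of `r - 1/2` and `r +
1/2` differ only at `r = 0`, which produces the extra exponential. -/
theorem tsum_errTerm_add_one {κ : ℝ} (hκ : 0 < κ) (w : ℂ) (p : ℝ) :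
    ∑' r, errTerm κ w (p + 1) r =
      exp (2 * Real.pi * I * w) * ∑' r, errTerm κ w p r - 2 * exp (Real.pi * I * w) := by
  have h : ∀ r : ℤ, errTerm κ w (p + 1) (Equiv.addRight (-1) r) =
      exp (2 * Real.pi * I * w) * errTerm κ w p r +
        if r = 0 then -2 * exp (Real.pi * I * w) else 0 := fun r => by
    have e1 : exp (-2 * Real.pi * I * ((Equiv.addRight (-1) r : ℤ) + 1 / 2) * w) =
        exp (2 * Real.pi * I * w) * exp (-2 * Real.pi * I * (r + 1 / 2) * w) := by
      rw [← exp_add]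
      simp only [Equiv.coe_addRight]
      push_cast
      ring_nf
    have e2 : (((Equiv.addRight (-1) r : ℤ) : ℝ) + 1 / 2 + (p + 1)) = r + 1 / 2 + p := by
      simp only [Equiv.coe_addRight]
      push_cast
      ring
    rw [errTerm, errTerm, e1, e2]
    split_ifs with hr
    · subst hr
      have e3 : exp (Real.pi * I * w) = exp (2 * Real.pi * I * w) *
          exp (-2 * Real.pi * I * ((0 : ℤ) + 1 / 2) * w) := by
        rw [← exp_add]
        push_cast
        ring_nf
      have e4 : SignType.sign ((((Equiv.addRight (-1) (0 : ℤ) : ℤ) : ℝ)) + 1 / 2) = -1 := by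
        apply sign_neg
        norm_num
      have e5 : SignType.sign (((0 : ℤ) : ℝ) + 1 / 2) = 1 := by
        apply sign_pos
        norm_num
      rw [e4, e5, e3]
      push_cast [SignType.coe_neg_one, SignType.coe_one]
      ring
    · have e4 : SignType.sign ((((Equiv.addRight (-1) r : ℤ) : ℝ)) + 1 / 2) =
          SignType.sign ((r : ℝ) + 1 / 2) := by
        simp only [Equiv.coe_addRight]
        push_cast
        rcases lt_or_gt_of_ne hr with h | h
        · have : (r : ℝ) ≤ -1 := by exact_mod_cast (by omega : r ≤ -1)
          rw [sign_neg (by linarith), sign_neg (by linarith)]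
        · have : (1 : ℝ) ≤ r := by exact_mod_cast (by omega : 1 ≤ r)
          rw [sign_pos (by linarith), sign_pos (by linarith)]
      rw [e4]
      ring
  rw [← (Equiv.addRight (-1 : ℤ)).tsum_eq, tsum_congr h,
    Summable.tsum_add ((summable_errTerm hκ w p).mul_left _) (hasSum_ite_eq 0 _).summable,
    tsum_mul_left, tsum_ite_eq]
  ring

theorem tsum_gaussTerm_div_add_one (κ : ℝ) (w : ℂ) (p : ℝ) :
    ∑' b : ℤ, gaussTerm κ w (p + 1) b / (w + b) =
      exp (2 * Real.pi * I * w) * ∑' b : ℤ, gaussTerm κ w p b / (w + b) := by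
  rw [← tsum_mul_left]
  refine tsum_congr fun b => ?_
  have h : exp (2 * Real.pi * I * w) = exp (2 * Real.pi * I * (w + b)) := by
    rw [mul_add, exp_add, exp_two_pi_I_mul_intCast, mul_one]
  rw [h, gaussTerm, gaussTerm, mul_div_assoc', mul_left_comm, ← exp_add]
  push_cast
  ring_nf

theorem hasDerivAt_tsum_gaussTerm_div {κ : ℝ} (hκ : 0 < κ) {w : ℂ} (hw : ∀ b : ℤ, w + b ≠ 0)
    (p : ℝ) : HasDerivAt (fun p => ∑' b : ℤ, gaussTerm κ w p b / (w + b))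
      (2 * Real.pi * I * ∑' b, gaussTerm κ w p b) p := by
  rw [← tsum_mul_left]
  have hs := ((summable_exp_neg_sq_add_abs (δ := Real.pi / κ ^ 2) (by positivity)
    |(-(2 * Real.pi / κ ^ 2 * w.re))|).mul_left (Real.exp (Real.pi / κ ^ 2 * w.im ^ 2 -
      Real.pi / κ ^ 2 * w.re ^ 2 + 2 * Real.pi * (|p| + 1) * |w.im|))).mul_left (2 * Real.pi)
  -- A bounded ball around `0` containing `p` suffices: the majorant is uniform for `|q| ≤ |p| + 1`.
  have hp : p ∈ Metric.ball (0 : ℝ) (|p| + 1) := by simp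
  refine hasDerivAt_tsum_of_isPreconnected hs Metric.isOpen_ball
    (convex_ball (0 : ℝ) (|p| + 1)).isPreconnected
    (fun b q _ => hasDerivAt_gaussTerm_div κ q (hw b)) (fun b q hq => ?_) hp
    (summable_gaussTerm_div hκ w p) hp
  have hq' : |q| ≤ |p| + 1 := by simpa using (mem_ball_zero_iff.1 hq).le
  have h1 : ‖(2 * Real.pi * I : ℂ)‖ = 2 * Real.pi := by simp [abs_of_pos Real.pi_pos]
  rw [norm_mul, h1]
  have h2 : -(2 * Real.pi / κ ^ 2 * w.re) * b ≤ |(-(2 * Real.pi / κ ^ 2 * w.re))| * |(b : ℝ)| := by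
    rw [← abs_mul]
    exact le_abs_self _
  refine mul_le_mul_of_nonneg_left ((norm_gaussTerm_le κ w hq' b).trans ?_) (by positivity)
  gcongr

theorem hasDerivAt_tsum_errTerm {κ : ℝ} (hκ : 0 < κ) (w : ℂ) (p : ℝ) :
    HasDerivAt (fun p => ∑' r, errTerm κ w p r) (-2 * ∑' r, dualTerm κ w p r) p := by
  rw [← tsum_mul_left]
  have hs := ((summable_exp_neg_sq_add_abs (δ := Real.pi * κ ^ 2 / 2) (by positivity)
    |2 * Real.pi * w.im - Real.pi * κ ^ 2 / 2|).mul_left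
      (κ * Real.exp (Real.pi * κ ^ 2 * (|p| + 1) ^ 2 + Real.pi * w.im))).mul_left 2
  have hp : p ∈ Metric.ball (0 : ℝ) (|p| + 1) := by simp
  refine hasDerivAt_tsum_of_isPreconnected hs Metric.isOpen_ball
    (convex_ball (0 : ℝ) (|p| + 1)).isPreconnected
    (fun r q _ => hasDerivAt_errTerm κ w q r) (fun r q hq => ?_) hp
    (summable_errTerm hκ w p) hp
  have hq' : |q| ≤ |p| + 1 := by simpa using (mem_ball_zero_iff.1 hq).le
  have h1 : ‖(-2 : ℂ)‖ = 2 := by simp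
  rw [norm_mul, h1]
  have h2 : (2 * Real.pi * w.im - Real.pi * κ ^ 2 / 2) * r ≤
      |2 * Real.pi * w.im - Real.pi * κ ^ 2 / 2| * |(r : ℝ)| := by
    rw [← abs_mul]
    exact le_abs_self _
  refine mul_le_mul_of_nonneg_left ((norm_dualTerm_le hκ w hq' r).trans ?_) zero_le_two
  gcongr

theorem exp_two_pi_I_mul_ne_one {w : ℂ} (hw : ∀ b : ℤ, w + b ≠ 0) :
    exp (2 * Real.pi * I * w) ≠ 1 := by
  intro h
  obtain ⟨n, hn⟩ := exp_eq_one_iff.1 h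
  rw [mul_comm] at hn
  have := mul_right_cancel₀ two_pi_I_ne_zero hn
  apply hw (-n)
  rw [this]
  push_cast
  ring

/-- Poisson summation for an alternating Gaussian series with a simple pole: the dual series is a
geometric series completed by error functions. -/
theorem tsum_gaussTerm_div_eq {κ : ℝ} (hκ : 0 < κ) {w : ℂ} (hw : ∀ b : ℤ, w + b ≠ 0) (p : ℝ) :
    -(2 * Real.pi * I)⁻¹ * ∑' b : ℤ, gaussTerm κ w p b / (w + b) =
      exp (Real.pi * I * w) / (1 - exp (2 * Real.pi * I * w)) +
        1 / 2 * ∑' r, errTerm κ w p r := by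
  set D : ℝ → ℂ := fun p => -(2 * Real.pi * I)⁻¹ * ∑' b : ℤ, gaussTerm κ w p b / (w + b) -
    (exp (Real.pi * I * w) / (1 - exp (2 * Real.pi * I * w)) +
      1 / 2 * ∑' r, errTerm κ w p r) with hD
  -- The geometric term does not depend on `p`. The remaining derivatives are minus the Gaussian
  -- series and minus its dual, equal by `tsum_gaussTerm`.
  have hd : ∀ p, HasDerivAt D 0 p := fun p => by
    refine (((hasDerivAt_tsum_gaussTerm_div hκ hw p).const_mul _).sub
      (((hasDerivAt_tsum_errTerm hκ w p).const_mul _).const_add _)).congr_deriv ?_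
    rw [tsum_gaussTerm hκ]
    have := two_pi_I_ne_zero
    field_simp
    ring
  have hc : D (p + 1) = D p :=
    is_const_of_deriv_eq_zero (fun q => (hd q).differentiableAt) (fun q => (hd q).deriv) _ _
  have hne : 1 - exp (2 * Real.pi * I * w) ≠ 0 :=
    sub_ne_zero.2 (exp_two_pi_I_mul_ne_one hw).symm
  -- The inhomogeneous term of `tsum_errTerm_add_one` is exactly what the geometric term needs: with
  -- `G = e^{πiw} / (1 - e^{2πiw})`, one has `G - e^{πiw} = e^{2πiw} G`.
  have hs : D (p + 1) = exp (2 * Real.pi * I * w) * D p := by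
    simp only [hD]
    rw [tsum_gaussTerm_div_add_one, tsum_errTerm_add_one hκ]
    have := two_pi_I_ne_zero
    field_simp
    ring
  have h0 : (1 - exp (2 * Real.pi * I * w)) * D p = 0 := by
    rw [sub_mul, one_mul, ← hs, hc, sub_self]
  exact sub_eq_zero.1 ((mul_eq_zero.1 h0).resolve_left hne)

/-! ### The theta functions and the non-holomorphic series -/

theorem summable_thetaMinusTerm (J : ℝ) {M : ℝ} (hM : 0 < M) {τ : ℂ} (hτ : 0 < τ.im) (z : ℂ) :
    Summable (thetaMinusTerm J M τ z) := by
  refine summable_of_norm_le_exp (δ := 2 * Real.pi * τ.im * M) (by positivity)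
    (-(2 * Real.pi * τ.im * J + 2 * Real.pi * M * z.im))
    (Real.exp (-(2 * Real.pi * τ.im * M) * (J / (2 * M)) ^ 2 -
      2 * Real.pi * M * z.im * (J / (2 * M)))) fun n => le_of_eq ?_
  have e1 : (2 * Real.pi * I * M * z * (n + J / (2 * M)) : ℂ) =
      ((2 * Real.pi * M * (n + J / (2 * M)) : ℝ) : ℂ) * (I * z) := by push_cast; ring
  have e2 : (2 * Real.pi * I * τ * (M * (n + J / (2 * M)) ^ 2) : ℂ) =
      ((2 * Real.pi * M * (n + J / (2 * M)) ^ 2 : ℝ) : ℂ) * (I * τ) := by push_cast; ring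
  rw [thetaMinusTerm, qPow, norm_mul, norm_mul, norm_neg_one_zpow, one_mul, norm_exp, norm_exp,
    e1, e2, re_ofReal_mul, re_ofReal_mul, I_mul_re, I_mul_re, ← Real.exp_add, ← Real.exp_add]
  congr 1
  field_simp
  ring

/-- The scale of the error functions in `zwegersTerm`. -/
noncomputable def errScale (m : ℕ) (τ : ℂ) : ℝ := Real.sqrt (τ.im / (m + 1 / 2))

theorem errScale_pos (m : ℕ) {τ : ℂ} (hτ : 0 < τ.im) : 0 < errScale m τ :=
  Real.sqrt_pos.2 (by positivity)

theorem errScale_sq (m : ℕ) {τ : ℂ} (hτ : 0 < τ.im) :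
    errScale m τ ^ 2 = τ.im / (m + 1 / 2) :=
  Real.sq_sqrt (by positivity)

/-- The exponential grows like `exp(π n² Im τ / (2m+1))`, but the error-function factor decays with
twice that rate, up to terms linear in `n`. -/
theorem summable_zwegersTerm (m : ℕ) (j : ℤ) {τ : ℂ} (hτ : 0 < τ.im) (v : ℂ) :
    Summable (zwegersTerm m j τ v) := by
  refine summable_of_norm_le_exp (δ := Real.pi * τ.im * (2 * m + 1)) (by positivity)
    (-(2 * Real.pi * τ.im * (j + 1 / 2) + 2 * Real.pi * (2 * m + 1) * v.im))
    (2 * Real.exp (-(Real.pi * τ.im / (2 * m + 1)) * (j + 1 / 2) ^ 2 -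
      2 * Real.pi * (j + 1 / 2) * v.im)) fun k => ?_
  have hN : (2 * m + 1 : ℝ) ≠ 0 := by positivity
  have hN' : (2 * m + 1 : ℂ) ≠ 0 := by exact_mod_cast hN
  set n : ℝ := (j + 1 / 2) + (2 * m + 1) * k with hn
  have e : (-(Real.pi * I * n ^ 2 * τ) / (2 * m + 1) - 2 * Real.pi * I * n * v : ℂ) =
      ((-(Real.pi * n ^ 2 / (2 * m + 1)) : ℝ) : ℂ) * (I * τ) +
        ((-2 * Real.pi * n : ℝ) : ℂ) * (I * v) := by
    push_cast
    ring
  have h1 := abs_sign_sub_erfE_le n ((2 * m + 1) * (v.im / τ.im)) (errScale_pos m hτ)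
  rw [zwegersTerm]
  simp only [← hn]
  rw [norm_mul, norm_mul, norm_neg_one_zpow, one_mul, norm_real, Real.norm_eq_abs, norm_exp, e,
    add_re, re_ofReal_mul, re_ofReal_mul, I_mul_re, I_mul_re]
  refine (mul_le_mul_of_nonneg_right h1 (Real.exp_pos _).le).trans (le_of_eq ?_)
  rw [mul_assoc 2 (Real.exp _), mul_assoc 2 (Real.exp _), ← Real.exp_add, ← Real.exp_add,
    errScale_sq m hτ, hn]
  congr 2
  field_simp
  ring

theorem neg_one_zpow_two_mul_add_one_mul (m : ℕ) (k : ℤ) :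
    (-1 : ℂ) ^ ((2 * (m : ℤ) + 1) * k) = (-1) ^ k := by
  rw [zpow_mul, Odd.neg_one_zpow ⟨m, rfl⟩]

/-- The substitution `k ↦ -k - 1` sends `n` to `-n`. The bracket `sgn - E` and the alternating sign
each change sign, and the two changes cancel. -/
theorem zwegersR_neg (m : ℕ) (j : ℤ) (τ v : ℂ) :
    zwegersR m j τ (-v) = zwegersR m (2 * m - j) τ v := by
  rw [zwegersR, zwegersR, ← ((Equiv.neg ℤ).trans (Equiv.addRight (-1))).tsum_eq]
  refine tsum_congr fun k => ?_
  simp only [Equiv.trans_apply, Equiv.neg_apply, Equiv.coe_addRight, zwegersTerm,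
    neg_one_zpow_two_mul_add_one_mul]
  set n : ℝ := (j : ℝ) + 1 / 2 + (2 * m + 1) * ((-k + -1 : ℤ) : ℝ) with hn
  have e1 : ((2 * m - j : ℤ) : ℝ) + 1 / 2 + (2 * m + 1) * (k : ℝ) = -n := by
    rw [hn]
    push_cast
    ring
  have e2 : (-1 : ℂ) ^ (-k + -1) = -(-1) ^ k := by
    rw [zpow_add₀ (by norm_num), zpow_neg, ← inv_zpow]
    norm_num
  have e3 : (n + (2 * m + 1) * ((-v).im / τ.im)) * √(τ.im / (m + 1 / 2)) =
      -((-n + (2 * m + 1) * (v.im / τ.im)) * √(τ.im / (m + 1 / 2))) := by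
    rw [neg_im]
    ring
  have e4 : ((SignType.sign n : SignType) : ℝ) = -((SignType.sign (-n) : SignType) : ℝ) := by
    rw [Left.sign_neg, SignType.coe_neg, neg_neg]
  rw [e1, e2, e3, e4, erfE_neg]
  push_cast
  ring_nf

/-- Shifting the summation index by one adds `2m + 1` to the theta index and costs one alternating
sign. -/
theorem thetaMinus_neg_half (m : ℕ) (j : ℤ) (τ z : ℂ) :
    thetaMinus (-(j + 1 / 2)) (m + 1 / 2) τ z =
      -thetaMinus ((2 * m - j : ℤ) + 1 / 2) (m + 1 / 2) τ z := by
  rw [thetaMinus, thetaMinus, ← (Equiv.addRight (1 : ℤ)).tsum_eq, ← tsum_neg]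
  refine tsum_congr fun n => ?_
  have hN : (2 * m + 1 : ℂ) ≠ 0 := by exact_mod_cast (Nat.succ_ne_zero (2 * m))
  have e : (((n + 1 : ℤ) : ℂ) + ((-(j + 1 / 2) : ℝ) : ℂ) / (2 * ((m + 1 / 2 : ℝ) : ℂ))) =
      n + (((2 * m - j : ℤ) + 1 / 2 : ℝ) : ℂ) / (2 * ((m + 1 / 2 : ℝ) : ℂ)) := by
    push_cast
    have : (2 * (m + 1 / 2) : ℂ) = 2 * m + 1 := by ring
    rw [this]
    field_simp
    ring
  simp only [Equiv.coe_addRight, thetaMinusTerm]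
  rw [e, zpow_add₀ (by norm_num)]
  ring

/-- The factor of automorphy `(-1) ^ a exp (2 π i (2m+1) a u + π i (2m+1) a² τ)` in the variable
`u`. -/
noncomputable def autFactor (m : ℕ) (τ u : ℂ) (a : ℤ) : ℂ :=
  (-1) ^ a * exp (2 * Real.pi * I * (2 * m + 1) * a * u + Real.pi * I * (2 * m + 1) * a ^ 2 * τ)

/-- The summand of the double series obtained by expanding the products
`zwegersR * thetaMinus`. -/
noncomputable def doubleTerm (m : ℕ) (τ u v : ℂ) (a r : ℤ) : ℂ :=
  autFactor m τ u a *
    errTerm (errScale m τ) (u + v + a * τ) ((2 * m + 1) * (v.im / τ.im)) r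

/-- With `n = j + 1/2 + (2m+1) k` and `a = l + k`, the theta variable is `a - n/(2m+1)`. Its square
contributes `n² τ/(2m+1)`, cancelling the indefinite part of the Zwegers term and leaving an
exponent linear in `n`, namely `-2πi n (u + v + a τ)`. -/
theorem zwegersTerm_mul_thetaMinusTerm (m : ℕ) (j : ℤ) (τ u v : ℂ) (k l : ℤ) :
    zwegersTerm m j τ v k * thetaMinusTerm (-(j + 1 / 2)) (m + 1 / 2) τ (2 * u) l =
      doubleTerm m τ u v (l + k) (j + (2 * m + 1) * k) := by
  have hN : (2 * m + 1 : ℂ) ≠ 0 := by exact_mod_cast (Nat.succ_ne_zero (2 * m))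
  have e1 : (((j + (2 * m + 1) * k : ℤ) : ℝ) + 1 / 2) = (j + 1 / 2) + (2 * m + 1) * k := by
    push_cast
    ring
  have e2 : (2 * (m + 1 / 2) : ℂ) = 2 * m + 1 := by ring
  simp only [zwegersTerm, thetaMinusTerm, doubleTerm, autFactor, errTerm, errScale, e1, qPow,
    neg_one_zpow_two_mul_add_one_mul]
  rw [zpow_add₀ (by norm_num)]
  generalize ((((SignType.sign ((j + 1 / 2) + (2 * m + 1) * k : ℝ) : SignType) : ℝ) -
    erfE (((j + 1 / 2) + (2 * m + 1) * k + (2 * m + 1) * (v.im / τ.im)) *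
      √(τ.im / (m + 1 / 2))) : ℝ) : ℂ) = c
  have aux : ∀ s₁ s₂ x y z x' y' : ℂ, x + y + z = x' + y' →
      s₁ * c * exp x * (s₂ * exp y * exp z) = s₂ * s₁ * exp x' * (c * exp y') :=
    fun s₁ s₂ x y z x' y' h => by
      have h' := congrArg exp h
      simp only [exp_add] at h'
      linear_combination s₁ * c * s₂ * h'
  apply aux
  push_cast
  rw [e2]
  field_simp
  ring

theorem hasSum_zwegersR_mul_thetaMinus (m : ℕ) (j : ℤ) {τ : ℂ} (hτ : 0 < τ.im) (u v : ℂ) :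
    HasSum (fun a : ℤ => ∑' k : ℤ, doubleTerm m τ u v a (j + (2 * m + 1) * k))
      (zwegersR m j τ v * thetaMinus (-(j + 1 / 2)) (m + 1 / 2) τ (2 * u)) := by
  have h1 := (summable_zwegersTerm m j hτ v).norm
  have h2 := (summable_thetaMinusTerm (-(j + 1 / 2)) (M := m + 1 / 2) (by positivity) hτ
    (2 * u)).norm
  have hs := summable_mul_of_summable_norm h1 h2
  -- Here `(a, k) ↦ (k, l)` with `l = a - k`, so that the outer sum becomes the sum over `a`.
  let e : ℤ × ℤ ≃ ℤ × ℤ :=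
    { toFun := fun p => (p.2, p.1 - p.2)
      invFun := fun p => (p.2 + p.1, p.1)
      left_inv := fun p => by ext <;> simp
      right_inv := fun p => by ext <;> simp }
  have he : (fun p : ℤ × ℤ => zwegersTerm m j τ v p.1 *
      thetaMinusTerm (-(j + 1 / 2)) (m + 1 / 2) τ (2 * u) p.2) ∘ e =
      fun p => doubleTerm m τ u v p.1 (j + (2 * m + 1) * p.2) := by
    funext p
    simp only [Function.comp, e, Equiv.coe_fn_mk, zwegersTerm_mul_thetaMinusTerm, sub_add_cancel]
  have hs' := (e.summable_iff).2 hs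
  rw [he] at hs'
  have ht : zwegersR m j τ v * thetaMinus (-(j + 1 / 2)) (m + 1 / 2) τ (2 * u) =
      ∑' p : ℤ × ℤ, doubleTerm m τ u v p.1 (j + (2 * m + 1) * p.2) := by
    rw [zwegersR, thetaMinus, tsum_mul_tsum_of_summable_norm h1 h2, ← e.tsum_eq]
    exact tsum_congr fun p => congrFun he p
  rw [ht, hs'.tsum_prod]
  exact hs'.prod.hasSum

theorem tsum_eq_sum_range_tsum {N : ℕ} (hN : N ≠ 0) {f : ℤ → ℂ} (hf : Summable f) :
    ∑' r, f r = ∑ j ∈ Finset.range N, ∑' k : ℤ, f (j + N * k) := by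
  have : NeZero N := ⟨hN⟩
  have hs : Summable fun p : Fin N × ℤ => f ((p.1 : ℕ) + N * p.2) := by
    have := ((Equiv.prodComm _ _).trans (Int.divModEquiv N).symm).summable_iff.2 hf
    refine this.congr fun p => ?_
    simp [Int.divModEquiv, mul_comm, add_comm]
  rw [← ((Equiv.prodComm _ _).trans (Int.divModEquiv N).symm).tsum_eq,
    Finset.sum_range fun j => ∑' k : ℤ, f (j + N * k), ← tsum_fintype (L := .unconditional _),
    ← hs.tsum_prod]
  refine tsum_congr fun p => ?_
  simp [Int.divModEquiv, mul_comm, add_comm]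

theorem hasSum_tsum_doubleTerm (m : ℕ) {τ : ℂ} (hτ : 0 < τ.im) (u v : ℂ) :
    HasSum (fun a : ℤ => ∑' r, doubleTerm m τ u v a r)
      (∑ j ∈ Finset.range (2 * m + 1),
        zwegersR m j τ v * thetaMinus (-(j + 1 / 2)) (m + 1 / 2) τ (2 * u)) := by
  have h := hasSum_sum (s := Finset.range (2 * m + 1))
    fun (j : ℕ) _ => hasSum_zwegersR_mul_thetaMinus m j hτ u v
  refine h.congr_fun fun a => ?_
  have hs : Summable (doubleTerm m τ u v a) :=
    (summable_errTerm (errScale_pos m hτ) _ _).mul_left _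
  rw [tsum_eq_sum_range_tsum (Nat.succ_ne_zero (2 * m)) hs]
  push_cast
  rfl

/-! ### The lattice sum -/

/-- The summand of the lattice sum, with `w = u + v + a τ + b`. -/
noncomputable def latticeTerm (m : ℕ) (τ u v : ℂ) (p : ℤ × ℤ) : ℂ :=
  (-1) ^ (p.1 + p.2) *
    exp (2 * Real.pi * I * (2 * m + 1) * p.1 * u + Real.pi * I * (2 * m + 1) * p.1 ^ 2 * τ -
      Real.pi * (2 * m + 1) / (2 * τ.im) * (u + v + p.1 * τ + p.2) ^ 2 +
      2 * Real.pi * I * (2 * m + 1) * (v.im / τ.im) * (u + v + p.1 * τ + p.2)) /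
    (u + v + p.1 * τ + p.2)

/-- The Gaussian lattice sum that completes the Appell-Lerch series `∑ j, numTerm m τ z₁ z₂ j`. -/
noncomputable def latticeSum (m : ℕ) (τ u v : ℂ) : ℂ := ∑' p, latticeTerm m τ u v p

theorem latticeTerm_eq (m : ℕ) {τ : ℂ} (hτ : 0 < τ.im) (u v : ℂ) (a b : ℤ) :
    latticeTerm m τ u v (a, b) = autFactor m τ u a *
      (gaussTerm (errScale m τ) (u + v + a * τ) ((2 * m + 1) * (v.im / τ.im)) b /
        (u + v + a * τ + b)) := by
  have hτ' : (τ.im : ℂ) ≠ 0 := ofReal_ne_zero.2 hτ.ne'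
  have h : (errScale m τ : ℂ) ^ 2 = τ.im / (m + 1 / 2) := by
    rw [← ofReal_pow, errScale_sq m hτ]
    push_cast
    ring
  have hN : (2 * m + 1 : ℂ) ≠ 0 := by exact_mod_cast (Nat.succ_ne_zero (2 * m))
  have hN' : (m + 1 / 2 : ℂ) ≠ 0 := fun h0 => hN (by linear_combination 2 * h0)
  rw [latticeTerm, autFactor, gaussTerm, h]
  have aux : ∀ s₁ s₂ x y z d : ℂ, x = y + z →
      s₁ * s₂ * exp x / d = s₁ * exp y * (s₂ * exp z / d) :=
    fun s₁ s₂ x y z d h => by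
      rw [h, exp_add]
      ring
  rw [zpow_add₀ (by norm_num)]
  apply aux
  push_cast
  field_simp
  ring

theorem exists_mul_sq_le_normSq {τ : ℂ} (hτ : 0 < τ.im) :
    ∃ δ > 0, ∀ x y : ℝ, δ * (x ^ 2 + y ^ 2) ≤ (x * τ.re + y) ^ 2 + (x * τ.im) ^ 2 := by
  -- The constant comes from `y² ≤ 2 (x Re τ + y)² + 2 (x Re τ)²`, multiplied by `(Im τ)²`.
  refine ⟨τ.im ^ 2 / (1 + 2 * τ.re ^ 2 + 2 * τ.im ^ 2), by positivity, fun x y => ?_⟩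
  rw [div_mul_eq_mul_div, div_le_iff₀ (by positivity)]
  have h : x ^ 2 + y ^ 2 ≤ 2 * (x * τ.re + y) ^ 2 + (1 + 2 * τ.re ^ 2) * x ^ 2 := by
    nlinarith [sq_nonneg (2 * (x * τ.re) + y)]
  nlinarith [mul_le_mul_of_nonneg_left h (sq_nonneg τ.im),
    mul_nonneg (sq_nonneg (x * τ.re + y)) (sq_nonneg τ.re), sq_nonneg (x * τ.re + y),
    sq_nonneg (x * τ.im ^ 2), sq_nonneg (x * τ.im * τ.im)]

/-- The terms of the convergent Gaussian series tend to `0` along the cofinite filter, so their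
exponents tend to `-∞`. -/
theorem tendsto_sq_add_sq_cofinite :
    Filter.Tendsto (fun p : ℤ × ℤ => (p.1 : ℝ) ^ 2 + (p.2 : ℝ) ^ 2) Filter.cofinite
      Filter.atTop := by
  have h := (summable_exp_neg_sq_add_abs_prod one_pos 0).tendsto_cofinite_zero
  have h2 : Filter.Tendsto (fun p : ℤ × ℤ => Real.exp (-((p.1 : ℝ) ^ 2 + (p.2 : ℝ) ^ 2)))
      Filter.cofinite (nhds 0) := by simpa using h
  rw [Real.tendsto_exp_comp_nhds_zero] at h2
  exact (Filter.tendsto_neg_atBot_atTop.comp h2).congr fun p => neg_neg _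

theorem eventually_one_le_norm_add {τ : ℂ} (hτ : 0 < τ.im) (z : ℂ) :
    ∀ᶠ p : ℤ × ℤ in Filter.cofinite, 1 ≤ ‖z + p.1 * τ + p.2‖ := by
  obtain ⟨δ, hδ, h⟩ := exists_mul_sq_le_normSq hτ
  filter_upwards [tendsto_sq_add_sq_cofinite.eventually_ge_atTop ((1 + ‖z‖) ^ 2 / δ)] with p hp
  rw [div_le_iff₀ hδ] at hp
  have h1 : (1 + ‖z‖) ^ 2 ≤ ‖p.1 * τ + p.2‖ ^ 2 := by
    rw [← normSq_eq_norm_sq, normSq_apply]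
    have := h p.1 p.2
    simp
    nlinarith
  have h2 := abs_le_of_sq_le_sq' h1 (norm_nonneg _)
  have h3 := norm_sub_le (z + p.1 * τ + p.2) z
  rw [show z + p.1 * τ + p.2 - z = p.1 * τ + p.2 by ring] at h3
  linarith [h2.2]

/-- The real part of `w²` is indefinite, but the automorphy factor contributes `-2c (a Im τ)²`.
Together the quadratic part is `-c |a τ + b|²`, which is negative definite. The poles matter at
finitely many points only. -/
theorem summable_latticeTerm (m : ℕ) {τ : ℂ} (hτ : 0 < τ.im) (u v : ℂ) :
    Summable (latticeTerm m τ u v) := by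
  obtain ⟨δ, hδ, h⟩ := exists_mul_sq_le_normSq hτ
  set c : ℝ := Real.pi * (2 * m + 1) / (2 * τ.im) with hc
  have hc0 : 0 < c := by positivity
  set L₁ : ℝ := -(2 * Real.pi * (2 * m + 1) * u.im) -
    2 * c * ((u + v).re * τ.re - (u + v).im * τ.im) - 2 * Real.pi * (2 * m + 1) * v.im
  set L₂ : ℝ := -(2 * c * (u + v).re)
  set K : ℝ := c * ((u + v).im ^ 2 - (u + v).re ^ 2) -
    2 * Real.pi * (2 * m + 1) * (v.im / τ.im) * (u + v).im
  refine Summable.of_norm_bounded_eventually ((summable_exp_neg_sq_add_abs_prod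
    (mul_pos hc0 hδ) (|L₁| + |L₂|)).mul_left (Real.exp K)) ?_
  filter_upwards [eventually_one_le_norm_add hτ (u + v)] with p hp
  rw [latticeTerm, norm_div, norm_mul, norm_neg_one_zpow, one_mul]
  refine (div_le_self (norm_nonneg _) hp).trans ?_
  rw [norm_exp, ← Real.exp_add]
  apply Real.exp_le_exp.2
  have e : (2 * Real.pi * I * (2 * m + 1) * p.1 * u + Real.pi * I * (2 * m + 1) * p.1 ^ 2 * τ -
      Real.pi * (2 * m + 1) / (2 * τ.im) * (u + v + p.1 * τ + p.2) ^ 2 +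
      2 * Real.pi * I * (2 * m + 1) * (v.im / τ.im) * (u + v + p.1 * τ + p.2) : ℂ) =
      ((2 * Real.pi * (2 * m + 1) * p.1 : ℝ) : ℂ) * (I * u) +
      ((Real.pi * (2 * m + 1) * p.1 ^ 2 : ℝ) : ℂ) * (I * τ) -
      (c : ℂ) * (u + v + p.1 * τ + p.2) ^ 2 +
      ((2 * Real.pi * (2 * m + 1) * (v.im / τ.im) : ℝ) : ℂ) * (I * (u + v + p.1 * τ + p.2)) := by
    rw [hc]
    push_cast
    ring
  have e2 : ((u + v + p.1 * τ + p.2) ^ 2).re =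
      ((u + v).re + (p.1 * τ.re + p.2)) ^ 2 - ((u + v).im + p.1 * τ.im) ^ 2 := by
    simp [pow_two]
    ring
  have e3 : (I * (u + v + p.1 * τ + p.2)).re = -((u + v).im + p.1 * τ.im) := by
    simp
  have e4 : Real.pi * (2 * m + 1) = c * (2 * τ.im) := by rw [hc]; field_simp
  have e5 : 2 * Real.pi * (2 * m + 1) * (v.im / τ.im) * (p.1 * τ.im) =
    2 * Real.pi * (2 * m + 1) * v.im * p.1 := by field_simp
  rw [e, add_re, sub_re, add_re, re_ofReal_mul, re_ofReal_mul, re_ofReal_mul, re_ofReal_mul, e2,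
    e3, I_mul_re, I_mul_re]
  have h1 := mul_le_mul_of_nonneg_left (h p.1 p.2) hc0.le
  have h2 : L₁ * p.1 + L₂ * p.2 ≤ (|L₁| + |L₂|) * (|(p.1 : ℝ)| + |(p.2 : ℝ)|) := by
    have a1 : L₁ * p.1 ≤ |L₁| * |(p.1 : ℝ)| := by rw [← abs_mul]; exact le_abs_self _
    have a2 : L₂ * p.2 ≤ |L₂| * |(p.2 : ℝ)| := by rw [← abs_mul]; exact le_abs_self _
    have a3 : 0 ≤ |L₁| * |(p.2 : ℝ)| := by positivity
    have a4 : 0 ≤ |L₂| * |(p.1 : ℝ)| := by positivity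
    linarith
  have h3 : 2 * Real.pi * (2 * m + 1) * p.1 * -u.im + Real.pi * (2 * m + 1) * p.1 ^ 2 * -τ.im -
      c * (((u + v).re + (p.1 * τ.re + p.2)) ^ 2 - ((u + v).im + p.1 * τ.im) ^ 2) +
      2 * Real.pi * (2 * m + 1) * (v.im / τ.im) * -((u + v).im + p.1 * τ.im) =
      K - c * ((p.1 * τ.re + p.2) ^ 2 + (p.1 * τ.im) ^ 2) + (L₁ * p.1 + L₂ * p.2) := by
    simp only [K, L₁, L₂]
    linear_combination (-(p.1 : ℝ) ^ 2 * τ.im) * e4 - e5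
  rw [h3]
  linarith

/-- This is `tsum_gaussTerm_div_eq` at `w = u + v + a τ`, with the same `p` for every row. The
off-lattice hypothesis keeps every `w + b` nonzero. -/
theorem tsum_latticeTerm_row (m : ℕ) {τ : ℂ} (hτ : 0 < τ.im) {u v : ℂ}
    (h : OffLattice τ (u + v)) (a : ℤ) :
    -(2 * Real.pi * I)⁻¹ * ∑' b : ℤ, latticeTerm m τ u v (a, b) =
      numTerm m τ (u + v) (u - v) a + 1 / 2 * ∑' r, doubleTerm m τ u v a r := by
  have hw : ∀ b : ℤ, u + v + a * τ + b ≠ 0 := fun b hb => by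
    apply h (-b) (-a)
    push_cast
    linear_combination hb
  have key := tsum_gaussTerm_div_eq (errScale_pos m hτ) hw ((2 * m + 1) * (v.im / τ.im))
  have e1 : exp (2 * Real.pi * I * (u + v + a * τ)) =
      exp (2 * Real.pi * I * (u + v)) * qPow τ a := by
    rw [qPow, ← exp_add]
    ring_nf
  have e2 : numTerm m τ (u + v) (u - v) a = autFactor m τ u a *
      (exp (Real.pi * I * (u + v + a * τ)) / (1 - exp (2 * Real.pi * I * (u + v + a * τ)))) := by
    rw [numTerm, autFactor, e1, mul_div_assoc, mul_div_assoc', mul_assoc, ← mul_div_assoc, qPow,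
      ← exp_add, mul_assoc ((-1) ^ a) (exp _), ← exp_add]
    ring_nf
  simp only [latticeTerm_eq m hτ, doubleTerm, tsum_mul_left]
  rw [mul_left_comm, key, e2]
  ring

/-- No direct estimate is needed: the row identity exhibits the terms as the difference of two
summable families. -/
theorem summable_numTerm_add_sub (m : ℕ) {τ : ℂ} (hτ : 0 < τ.im) {u v : ℂ}
    (h : OffLattice τ (u + v)) : Summable (numTerm m τ (u + v) (u - v)) := by
  have h1 := ((summable_latticeTerm m hτ u v).prod.mul_left (-(2 * Real.pi * I)⁻¹)).sub
    ((hasSum_tsum_doubleTerm m hτ u v).summable.mul_left (1 / 2))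
  refine h1.congr fun a => ?_
  rw [tsum_latticeTerm_row m hτ h]
  ring

theorem summable_numTerm (m : ℕ) {τ : ℂ} (hτ : 0 < τ.im) {z₁ : ℂ} (h : OffLattice τ z₁)
    (z₂ : ℂ) : Summable (numTerm m τ z₁ z₂) := by
  have e1 : (z₁ + z₂) / 2 + (z₁ - z₂) / 2 = z₁ := by ring
  have e2 : (z₁ + z₂) / 2 - (z₁ - z₂) / 2 = z₂ := by ring
  have := summable_numTerm_add_sub m hτ (u := (z₁ + z₂) / 2) (v := (z₁ - z₂) / 2) (by rwa [e1])
  rwa [e1, e2] at this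

/-- The completed Appell-Lerch series is a lattice sum. -/
theorem tsum_numTerm_add_eq_latticeSum (m : ℕ) {τ : ℂ} (hτ : 0 < τ.im) {u v : ℂ}
    (h : OffLattice τ (u + v)) :
    ∑' a, numTerm m τ (u + v) (u - v) a +
      1 / 2 * ∑ j ∈ Finset.range (2 * m + 1),
        zwegersR m j τ v * thetaMinus (-(j + 1 / 2)) (m + 1 / 2) τ (2 * u) =
      -(2 * Real.pi * I)⁻¹ * latticeSum m τ u v := by
  have hd := hasSum_tsum_doubleTerm m hτ u v
  rw [latticeSum, (summable_latticeTerm m hτ u v).tsum_prod, ← tsum_mul_left,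
    tsum_congr (tsum_latticeTerm_row m hτ h),
    (summable_numTerm_add_sub m hτ h).tsum_add (hd.summable.mul_left _), tsum_mul_left, hd.tsum_eq]

/-- The identity for the first Appell-Lerch series accounts for the theta functions of index `-(j +
1/2)`. The second series is the first at `-v`, and the reflection `j ↦ 2m - j` turns its correction
into minus the part with index `j + 1/2`. -/
theorem phiMod_eq_latticeSum (m : ℕ) {τ : ℂ} (hτ : 0 < τ.im) {u v : ℂ}
    (h₁ : OffLattice τ (u + v)) (h₂ : OffLattice τ (u - v)) (t : ℂ) :
    phiMod m τ u v t = exp (2 * Real.pi * I * (m + 1 / 2) * t) *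
      (-(2 * Real.pi * I)⁻¹ * (latticeSum m τ u v - latticeSum m τ u (-v))) := by
  have k1 := tsum_numTerm_add_eq_latticeSum m hτ h₁
  have k2 := tsum_numTerm_add_eq_latticeSum m hτ (u := u) (v := -v) (by rwa [← sub_eq_add_neg])
  rw [sub_neg_eq_add, ← sub_eq_add_neg] at k2
  have hsum : ∑ j ∈ Finset.range (2 * m + 1),
        zwegersR m j τ (-v) * thetaMinus (-(j + 1 / 2)) (m + 1 / 2) τ (2 * u) =
      -∑ j ∈ Finset.range (2 * m + 1),
        zwegersR m j τ v * thetaMinus (j + 1 / 2) (m + 1 / 2) τ (2 * u) := by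
    rw [← Finset.sum_range_reflect, ← Finset.sum_neg_distrib]
    refine Finset.sum_congr rfl fun j hj => ?_
    have hj' : j ≤ 2 * m := by simpa [Nat.lt_succ_iff] using hj
    have e : ((2 * m + 1 - 1 - j : ℕ) : ℤ) = 2 * m - j := by omega
    have e1 := zwegersR_neg m (2 * m - j) τ v
    have e2 := thetaMinus_neg_half m (2 * m - j) τ (2 * u)
    rw [sub_sub_cancel] at e1 e2
    have e' : ((2 * m + 1 - 1 - j : ℕ) : ℝ) = ((2 * m - j : ℤ) : ℝ) := by rw [← e]; simp
    rw [e, e', e1, e2, Int.cast_natCast, mul_neg]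
  rw [hsum] at k2
  simp only [phiMod, phi, num, num₁, phiAdd]
  rw [Finset.sum_congr rfl fun j _ => mul_add _ _ _, Finset.sum_add_distrib]
  linear_combination exp (2 * Real.pi * I * (m + 1 / 2) * t) * (k1 - k2)

/-! ### Transformation laws of the lattice sum -/

theorem exp_eq_exp_of_eq_add {x y : ℂ} (n : ℤ) (h : x = y + 2 * Real.pi * I * n) :
    exp x = exp y := by
  rw [h, exp_add, exp_two_pi_I_mul_intCast, mul_one]

theorem latticeSum_S (m : ℕ) {τ : ℂ} (hτ : 0 < τ.im) (u v : ℂ) :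
    latticeSum m (-1 / τ) (u / τ) (v / τ) =
      τ * exp (Real.pi * I * (2 * m + 1) * (u ^ 2 - v ^ 2) / τ) * latticeSum m τ u v := by
  have hτ0 : τ ≠ 0 := fun h => by simp [h] at hτ
  have hτ' : (τ.im : ℂ) ≠ 0 := ofReal_ne_zero.2 hτ.ne'
  have hn : (normSq τ : ℂ) ≠ 0 := ofReal_ne_zero.2 (normSq_pos.2 hτ0).ne'
  -- Writing the conjugate of `τ` as `τ - 2i Im τ` makes `Im(-1/τ)` and `Im(v/τ)` rational in `τ`,
  -- `v`, `Im τ` and `Im v`, so that the comparison of exponents becomes a field identity.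
  have hconj : (starRingEnd ℂ) τ = τ - 2 * I * τ.im := by
    apply Complex.ext <;> simp
    ring
  have hnorm : (normSq τ : ℂ) = τ * (τ - 2 * I * τ.im) := by rw [← hconj, mul_conj]
  have hi : ((-1 / τ).im : ℂ) = τ.im / (τ * (τ - 2 * I * τ.im)) := by
    rw [← hnorm, ← ofReal_div]
    simp [neg_div]
  have hv : ((v / τ).im : ℂ) = (v.im * τ - τ.im * v) / (τ * (τ - 2 * I * τ.im)) := by
    rw [← hnorm, eq_div_iff hn, ← ofReal_mul]
    have : (v / τ).im * normSq τ = v.im * τ.re - τ.im * v.re := by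
      have := (normSq_pos.2 hτ0).ne'
      rw [div_im]
      field_simp
    rw [this]
    apply Complex.ext <;> simp
    ring
  have hne : τ - 2 * I * τ.im ≠ 0 := fun h => hn (by rw [hnorm, h, mul_zero])
  -- Dividing `u + v + b τ - a` by `τ` gives the lattice point with coefficients `(a, b)` for
  -- `-1/τ`.
  let e : ℤ × ℤ ≃ ℤ × ℤ :=
    { toFun := fun p => (p.2, -p.1)
      invFun := fun p => (-p.2, p.1)
      left_inv := fun p => by simp
      right_inv := fun p => by simp }
  rw [latticeSum, latticeSum, ← e.tsum_eq (latticeTerm m τ u v), ← tsum_mul_left]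
  refine tsum_congr fun ⟨a, b⟩ => ?_
  simp only [latticeTerm, e, Equiv.coe_fn_mk]
  have hs : (-1 : ℂ) ^ (b + -a) = (-1) ^ (a + b) := by
    rw [zpow_add₀ (by norm_num), zpow_add₀ (by norm_num), zpow_neg, ← inv_zpow]
    norm_num
    ring
  set w : ℂ := u + v + b * τ + ((-a : ℤ) : ℂ) with hw
  have hw' : u / τ + v / τ + a * (-1 / τ) + b = w / τ := by
    rw [hw]
    push_cast
    field_simp
    ring
  have hE : exp (2 * Real.pi * I * (2 * m + 1) * a * (u / τ) +
        Real.pi * I * (2 * m + 1) * a ^ 2 * (-1 / τ) -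
        Real.pi * (2 * m + 1) / (2 * (-1 / τ).im) * (w / τ) ^ 2 +
        2 * Real.pi * I * (2 * m + 1) * ((v / τ).im / (-1 / τ).im) * (w / τ)) =
      exp (Real.pi * I * (2 * m + 1) * (u ^ 2 - v ^ 2) / τ) *
        exp (2 * Real.pi * I * (2 * m + 1) * b * u + Real.pi * I * (2 * m + 1) * b ^ 2 * τ -
        Real.pi * (2 * m + 1) / (2 * τ.im) * w ^ 2 +
        2 * Real.pi * I * (2 * m + 1) * (v.im / τ.im) * w) := by
    rw [← exp_add, hi, hv]
    apply exp_eq_exp_of_eq_add (-(2 * m + 1) * (a * b))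
    rw [hw]
    push_cast
    field_simp
    ring
  rw [hw', hE, hs, div_div_eq_mul_div]
  ring

theorem latticeSum_T (m : ℕ) (τ u v : ℂ) :
    latticeSum m (τ + 1) u v = latticeSum m τ u v := by
  let e : ℤ × ℤ ≃ ℤ × ℤ :=
    { toFun := fun p => (p.1, p.1 + p.2)
      invFun := fun p => (p.1, p.2 - p.1)
      left_inv := fun p => by simp
      right_inv := fun p => by simp }
  rw [latticeSum, latticeSum, ← e.tsum_eq (latticeTerm m τ u v)]
  refine tsum_congr fun ⟨a, b⟩ => ?_
  simp only [latticeTerm, e, Equiv.coe_fn_mk, add_im, one_im, add_zero]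
  have hw : u + v + a * (τ + 1) + b = u + v + a * τ + ((a + b : ℤ) : ℂ) := by
    push_cast
    ring
  -- The new factor `exp(πi (2m+1) a²)` equals `(-1) ^ a` because `(2m+1) a²` and `a` have the same
  -- parity; it compensates the sign from `b ↦ a + b`.
  have hs : (-1 : ℂ) ^ (a + (a + b)) = (-1) ^ (a + b) * exp (Real.pi * I * (2 * m + 1) * a ^ 2) := by
    have : (-1 : ℂ) ^ a = (-1) ^ ((2 * (m : ℤ) + 1) * a ^ 2) := by
      rw [neg_one_zpow_two_mul_add_one_mul]
      rcases Int.even_or_odd a with h | h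
      · rw [h.neg_one_zpow, (h.pow_of_ne_zero two_ne_zero).neg_one_zpow]
      · rw [h.neg_one_zpow, h.pow.neg_one_zpow]
    rw [zpow_add₀ (by norm_num), mul_comm, this, neg_one_zpow_eq_exp ((2 * (m : ℤ) + 1) * a ^ 2)]
    push_cast
    ring_nf
  rw [hw, hs, mul_assoc ((-1) ^ (a + b)), ← exp_add]
  congr 3
  ring

theorem latticeSum_add_int (m : ℕ) (τ u v : ℂ) (a b : ℤ) :
    latticeSum m τ (u + a) (v + b) = (-1) ^ (a + b) * latticeSum m τ u v := by
  rw [latticeSum, latticeSum,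
    ← ((Equiv.refl ℤ).prodCongr (Equiv.addRight (a + b))).tsum_eq (latticeTerm m τ u v),
    ← tsum_mul_left]
  refine tsum_congr fun ⟨c, d⟩ => ?_
  simp only [latticeTerm, Equiv.prodCongr_apply, Prod.map, Equiv.refl_apply, Equiv.coe_addRight]
  have hw : u + a + (v + b) + c * τ + d = u + v + c * τ + ((d + (a + b) : ℤ) : ℂ) := by
    push_cast
    ring
  have hs : (-1 : ℂ) ^ (c + d) = (-1) ^ (a + b) * (-1) ^ (c + (d + (a + b))) := by
    rw [← zpow_add₀ (by norm_num), show a + b + (c + (d + (a + b))) = c + d + 2 * (a + b) by ring,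
      zpow_add₀ (by norm_num) (c + d), (even_two_mul _).neg_one_zpow, mul_one]
  have hE : ∀ x y : ℂ, exp (2 * Real.pi * I * (2 * m + 1) * c * (u + a) + x - y) =
      exp (2 * Real.pi * I * (2 * m + 1) * c * u + x - y) := fun x y => by
    apply exp_eq_exp_of_eq_add ((2 * m + 1) * (c * a))
    push_cast
    ring
  have him : (v + b).im = v.im := by simp
  rw [hw, hs, him, exp_add _ (2 * Real.pi * I * (2 * m + 1) * (v.im / τ.im) * _), hE, ← exp_add]
  ring

theorem latticeSum_add_mul (m : ℕ) {τ : ℂ} (hτ : 0 < τ.im) (u v : ℂ) (a b : ℤ) :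
    latticeSum m τ (u + a * τ) (v + b * τ) = (-1) ^ (a + b) *
      exp (2 * Real.pi * I * (2 * m + 1) * (b * v - a * u)) *
      qPow τ ((m + 1 / 2) * (b ^ 2 - a ^ 2)) * latticeSum m τ u v := by
  have hτ' : (τ.im : ℂ) ≠ 0 := ofReal_ne_zero.2 hτ.ne'
  rw [latticeSum, latticeSum,
    ← ((Equiv.addRight (a + b)).prodCongr (Equiv.refl ℤ)).tsum_eq (latticeTerm m τ u v),
    ← tsum_mul_left]
  refine tsum_congr fun ⟨c, d⟩ => ?_
  simp only [latticeTerm, Equiv.prodCongr_apply, Prod.map, Equiv.refl_apply, Equiv.coe_addRight]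
  have hw : u + a * τ + (v + b * τ) + c * τ + d = u + v + ((c + (a + b) : ℤ) : ℂ) * τ + d := by
    push_cast
    ring
  have hs : (-1 : ℂ) ^ (c + d) = (-1) ^ (a + b) * (-1) ^ (c + (a + b) + d) := by
    rw [← zpow_add₀ (by norm_num), show a + b + (c + (a + b) + d) = c + d + 2 * (a + b) by ring,
      zpow_add₀ (by norm_num) (c + d), (even_two_mul _).neg_one_zpow, mul_one]
  have him : ((v + b * τ).im : ℂ) = v.im + b * τ.im := by simp
  rw [hw, hs, him, qPow]
  have aux : ∀ s₁ s₂ x y z w d : ℂ, exp x = exp (y + z + w) →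
      s₁ * s₂ * exp x / d = s₁ * exp y * exp z * (s₂ * exp w / d) := fun s₁ s₂ x y z w d h => by
    rw [h, exp_add, exp_add]
    ring
  apply aux
  -- Moving `v` by `b τ` raises `p` by the integer `(2m+1) b`, so the integer part `d` of `w`
  -- contributes only a multiple of `2πi`.
  apply exp_eq_exp_of_eq_add ((2 * m + 1) * (b * d))
  push_cast
  field_simp
  ring

theorem latticeSum_neg (m : ℕ) (τ u v : ℂ) :
    latticeSum m τ (-u) (-v) = -latticeSum m τ u v := by
  rw [latticeSum, latticeSum,
    ← ((Equiv.neg ℤ).prodCongr (Equiv.neg ℤ)).tsum_eq (latticeTerm m τ u v), ← tsum_neg]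
  refine tsum_congr fun ⟨c, d⟩ => ?_
  simp only [latticeTerm, Equiv.prodCongr_apply, Prod.map, Equiv.neg_apply]
  have hw : -u + -v + c * τ + d = -(u + v + ((-c : ℤ) : ℂ) * τ + ((-d : ℤ) : ℂ)) := by
    push_cast
    ring
  have hs : (-1 : ℂ) ^ (-c + -d) = (-1) ^ (c + d) := by
    rw [← neg_add, zpow_neg, ← inv_zpow]
    norm_num
  rw [hw, hs, div_neg]
  congr 4
  push_cast
  rw [neg_im]
  push_cast
  ring

/-! ### Transformation laws of the modified numerator -/

theorem OffLattice.neg {τ z : ℂ} (h : OffLattice τ z) : OffLattice τ (-z) := fun n k hz =>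
  h (-n) (-k) (by push_cast; linear_combination -hz)

theorem OffLattice.add {τ z : ℂ} (h : OffLattice τ z) (a b : ℤ) :
    OffLattice τ (z + a + b * τ) := fun n k hz =>
  h (n - a) (k - b) (by push_cast; linear_combination hz)

theorem OffLattice.add_one {τ z : ℂ} (h : OffLattice τ z) : OffLattice (τ + 1) z :=
  fun n k hz => h (n + k) k (by push_cast; linear_combination hz)

theorem OffLattice.div {τ z : ℂ} (hτ : τ ≠ 0) (h : OffLattice τ z) :
    OffLattice (-1 / τ) (z / τ) := fun n k hz => h (-k) n (by
  field_simp at hz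
  push_cast
  linear_combination hz)

theorem numMod_eq_phiMod (m : ℕ) (τ z₁ z₂ t : ℂ) :
    numMod m τ z₁ z₂ t = phiMod m τ ((z₁ + z₂) / 2) ((z₁ - z₂) / 2) t := by
  have e1 : (z₁ + z₂) / 2 + (z₁ - z₂) / 2 = z₁ := by ring
  have e2 : (z₁ + z₂) / 2 - (z₁ - z₂) / 2 = z₂ := by ring
  have e3 : 2 * ((z₁ + z₂) / 2) = z₁ + z₂ := by ring
  rw [numMod, phiMod, phi, numAdd, phiAdd, e1, e2, e3]

theorem phiMod_S (m : ℕ) {τ : ℂ} (hτ : 0 < τ.im) {u v : ℂ} (h₁ : OffLattice τ (u + v))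
    (h₂ : OffLattice τ (u - v)) (t : ℂ) :
    phiMod m (-1 / τ) (u / τ) (v / τ) (t + (v ^ 2 - u ^ 2) / τ) = τ * phiMod m τ u v t := by
  have hτ0 : τ ≠ 0 := fun h => by simp [h] at hτ
  have him : 0 < (-1 / τ).im := by
    have := normSq_pos.2 hτ0
    have e : (-1 / τ).im = τ.im / normSq τ := by simp [neg_div]
    rw [e]
    positivity
  have k := latticeSum_S m hτ u (-v)
  rw [neg_div τ v, neg_sq] at k
  rw [phiMod_eq_latticeSum m him (by rw [← add_div]; exact h₁.div hτ0)
    (by rw [← sub_div]; exact h₂.div hτ0), phiMod_eq_latticeSum m hτ h₁ h₂, latticeSum_S m hτ, k]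
  have e : exp (2 * Real.pi * I * (m + 1 / 2) * t) =
      exp (2 * Real.pi * I * (m + 1 / 2) * (t + (v ^ 2 - u ^ 2) / τ)) *
      exp (Real.pi * I * (2 * m + 1) * (u ^ 2 - v ^ 2) / τ) := by
    rw [← exp_add]
    congr 1
    field_simp
    ring
  rw [e]
  ring

theorem phiMod_T (m : ℕ) {τ : ℂ} (hτ : 0 < τ.im) {u v : ℂ} (h₁ : OffLattice τ (u + v))
    (h₂ : OffLattice τ (u - v)) (t : ℂ) : phiMod m (τ + 1) u v t = phiMod m τ u v t := by
  rw [phiMod_eq_latticeSum m (by simpa using hτ) h₁.add_one h₂.add_one,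
    phiMod_eq_latticeSum m hτ h₁ h₂, latticeSum_T, latticeSum_T]

theorem neg_one_zpow_add_neg (a b : ℤ) : (-1 : ℂ) ^ (a + -b) = (-1) ^ (a + b) := by
  rw [zpow_add₀ (by norm_num), zpow_add₀ (by norm_num), zpow_neg, ← inv_zpow]
  norm_num

theorem phiMod_add_int (m : ℕ) {τ : ℂ} (hτ : 0 < τ.im) {u v : ℂ} (h₁ : OffLattice τ (u + v))
    (h₂ : OffLattice τ (u - v)) (t : ℂ) (a b : ℤ) :
    phiMod m τ (u + a) (v + b) t = (-1) ^ (a + b) * phiMod m τ u v t := by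
  have k := latticeSum_add_int m τ u (-v) a (-b)
  rw [Int.cast_neg, ← neg_add, neg_one_zpow_add_neg] at k
  have h₁' : OffLattice τ (u + a + (v + b)) := by
    convert h₁.add (a + b) 0 using 1
    push_cast
    ring
  have h₂' : OffLattice τ (u + a - (v + b)) := by
    convert h₂.add (a - b) 0 using 1
    push_cast
    ring
  rw [phiMod_eq_latticeSum m hτ h₁' h₂', phiMod_eq_latticeSum m hτ h₁ h₂, latticeSum_add_int, k]
  ring

theorem phiMod_add_mul (m : ℕ) {τ : ℂ} (hτ : 0 < τ.im) {u v : ℂ} (h₁ : OffLattice τ (u + v))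
    (h₂ : OffLattice τ (u - v)) (t : ℂ) (a b : ℤ) :
    phiMod m τ (u + a * τ) (v + b * τ) t = (-1) ^ (a + b) *
      exp (2 * Real.pi * I * (2 * m + 1) * (b * v - a * u)) *
      qPow τ ((m + 1 / 2) * (b ^ 2 - a ^ 2)) * phiMod m τ u v t := by
  have k := latticeSum_add_mul m hτ u (-v) a (-b)
  rw [Int.cast_neg, neg_mul, ← neg_add, neg_one_zpow_add_neg, neg_mul_neg, neg_sq] at k
  have h₁' : OffLattice τ (u + a * τ + (v + b * τ)) := by
    convert h₁.add 0 (a + b) using 1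
    push_cast
    ring
  have h₂' : OffLattice τ (u + a * τ - (v + b * τ)) := by
    convert h₂.add 0 (a - b) using 1
    push_cast
    ring
  rw [phiMod_eq_latticeSum m hτ h₁' h₂', phiMod_eq_latticeSum m hτ h₁ h₂,
    latticeSum_add_mul m hτ, k]
  ring

theorem phiMod_neg_right (m : ℕ) {τ : ℂ} (hτ : 0 < τ.im) {u v : ℂ} (h₁ : OffLattice τ (u + v))
    (h₂ : OffLattice τ (u - v)) (t : ℂ) : phiMod m τ u (-v) t = -phiMod m τ u v t := by
  rw [phiMod_eq_latticeSum m hτ (by rwa [← sub_eq_add_neg]) (by rwa [sub_neg_eq_add]),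
    phiMod_eq_latticeSum m hτ h₁ h₂, neg_neg]
  ring

theorem phiMod_neg_left (m : ℕ) {τ : ℂ} (hτ : 0 < τ.im) {u v : ℂ} (h₁ : OffLattice τ (u + v))
    (h₂ : OffLattice τ (u - v)) (t : ℂ) : phiMod m τ (-u) v t = phiMod m τ u v t := by
  have k₁ := latticeSum_neg m τ u (-v)
  rw [neg_neg] at k₁
  have h₁' : OffLattice τ (-u + v) := by
    convert h₂.neg using 1
    ring
  have h₂' : OffLattice τ (-u - v) := by
    convert h₁.neg using 1
    ring
  rw [phiMod_eq_latticeSum m hτ h₁' h₂', phiMod_eq_latticeSum m hτ h₁ h₂, k₁, latticeSum_neg]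
  ring

end Osp32

theorem theorem4p14 (m : ℕ) (τ : ℂ) (hτ : 0 < τ.im) :
    -- absolute convergence of the defining series
    ((∀ z₁ z₂ : ℂ, Osp32.OffLattice τ z₁ → Summable (Osp32.numTerm m τ z₁ z₂)) ∧
      (∀ (j : ℤ) (z : ℂ), Summable (Osp32.thetaMinusTerm (j + 1 / 2) (m + 1 / 2) τ z)) ∧
      (∀ (j : ℤ) (v : ℂ), Summable (Osp32.zwegersTerm m j τ v))) ∧
    -- the modified numerator in the coordinates `z₁, z₂`
    (∀ z₁ z₂ t : ℂ, Osp32.OffLattice τ z₁ → Osp32.OffLattice τ z₂ →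
      Osp32.numMod m (-1 / τ) (z₁ / τ) (z₂ / τ) (t - z₁ * z₂ / τ) =
          τ * Osp32.numMod m τ z₁ z₂ t ∧
      Osp32.numMod m (τ + 1) z₁ z₂ t = Osp32.numMod m τ z₁ z₂ t ∧
      (∀ a b : ℤ, Even (a + b) →
        Osp32.numMod m τ (z₁ + a) (z₂ + b) t = (-1) ^ a * Osp32.numMod m τ z₁ z₂ t ∧
        Osp32.numMod m τ (z₁ + a * τ) (z₂ + b * τ) t =
          (-1) ^ a * Complex.exp (-2 * Real.pi * Complex.I * (m + 1 / 2) * (a * z₂ + b * z₁)) *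
            Osp32.qPow τ (-(m + 1 / 2) * a * b) * Osp32.numMod m τ z₁ z₂ t) ∧
      Osp32.numMod m τ z₂ z₁ t = -Osp32.numMod m τ z₁ z₂ t ∧
      Osp32.numMod m τ (-z₁) (-z₂) t = -Osp32.numMod m τ z₁ z₂ t) ∧
    -- the same function in the coordinates `u = (z₁ + z₂) / 2`, `v = (z₁ - z₂) / 2`
    (∀ z₁ z₂ t : ℂ,
      Osp32.numMod m τ z₁ z₂ t = Osp32.phiMod m τ ((z₁ + z₂) / 2) ((z₁ - z₂) / 2) t) ∧
    (∀ u v t : ℂ, Osp32.OffLattice τ (u + v) → Osp32.OffLattice τ (u - v) →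
      Osp32.phiMod m (-1 / τ) (u / τ) (v / τ) (t + (v ^ 2 - u ^ 2) / τ) =
          τ * Osp32.phiMod m τ u v t ∧
      Osp32.phiMod m (τ + 1) u v t = Osp32.phiMod m τ u v t ∧
      (∀ a b : ℤ,
        Osp32.phiMod m τ (u + a) (v + b) t = (-1) ^ (a + b) * Osp32.phiMod m τ u v t ∧
        Osp32.phiMod m τ (u + a * τ) (v + b * τ) t =
          (-1) ^ (a + b) *
            Complex.exp (2 * Real.pi * Complex.I * (2 * m + 1) * (b * v - a * u)) *
            Osp32.qPow τ ((m + 1 / 2) * (b ^ 2 - a ^ 2)) * Osp32.phiMod m τ u v t) ∧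
      Osp32.phiMod m τ u (-v) t = -Osp32.phiMod m τ u v t ∧
      Osp32.phiMod m τ (-u) v t = Osp32.phiMod m τ u v t) := by
  have hphi := fun (u v t : ℂ) (h₁ : Osp32.OffLattice τ (u + v))
      (h₂ : Osp32.OffLattice τ (u - v)) =>
    And.intro (Osp32.phiMod_S m hτ h₁ h₂ t) <| And.intro (Osp32.phiMod_T m hτ h₁ h₂ t) <|
    And.intro (fun a b : ℤ => And.intro (Osp32.phiMod_add_int m hτ h₁ h₂ t a b)
      (Osp32.phiMod_add_mul m hτ h₁ h₂ t a b)) <|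
    And.intro (Osp32.phiMod_neg_right m hτ h₁ h₂ t) (Osp32.phiMod_neg_left m hτ h₁ h₂ t)
  refine ⟨⟨fun z₁ z₂ h => Osp32.summable_numTerm m hτ h z₂, fun j z => ?_,
    fun j v => Osp32.summable_zwegersTerm m j hτ v⟩, fun z₁ z₂ t h₁ h₂ => ?_,
    Osp32.numMod_eq_phiMod m τ, hphi⟩
  · exact Osp32.summable_thetaMinusTerm _ (by positivity) hτ z
  have e₁ : (z₁ + z₂) / 2 + (z₁ - z₂) / 2 = z₁ := by ring
  have e₂ : (z₁ + z₂) / 2 - (z₁ - z₂) / 2 = z₂ := by ring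
  obtain ⟨hS, hT, hell, hr, hl⟩ := hphi ((z₁ + z₂) / 2) ((z₁ - z₂) / 2) t (by rwa [e₁])
    (by rwa [e₂])
  simp only [Osp32.numMod_eq_phiMod]
  refine ⟨?_, hT, fun a b hab => ?_, ?_, ?_⟩
  · rw [← hS]
    congr 1 <;> ring
  -- With `a + b = 2c`, the shift moves `u` by `c` and `v` by `(a - b)/2 = a - c`. These are
  -- integers by the parity condition, and the sign becomes `(-1) ^ (c + (a - c)) = (-1) ^ a`.
  · obtain ⟨c, hc⟩ := hab
    obtain ⟨hc₁, hc₂⟩ := hell c (a - c)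
    have hb : (b : ℂ) = 2 * c - a := by
      rw [← Int.cast_ofNat, ← Int.cast_mul, ← Int.cast_sub]
      congr 1
      omega
    rw [add_sub_cancel] at hc₁ hc₂
    constructor
    · rw [← hc₁, hb]
      push_cast
      congr 1 <;> ring
    · have hE : Complex.exp (-2 * Real.pi * Complex.I * (m + 1 / 2) * (a * z₂ + b * z₁)) *
          Osp32.qPow τ (-(m + 1 / 2) * a * b) =
          Complex.exp (2 * Real.pi * Complex.I * (2 * m + 1) *
            (((a - c : ℤ) : ℂ) * ((z₁ - z₂) / 2) - c * ((z₁ + z₂) / 2))) *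
          Osp32.qPow τ ((m + 1 / 2) * (((a - c : ℤ) : ℂ) ^ 2 - c ^ 2)) := by
        rw [Osp32.qPow, Osp32.qPow, ← Complex.exp_add, ← Complex.exp_add, hb]
        congr 1
        push_cast
        ring
      rw [mul_assoc ((-1) ^ a), hE, ← mul_assoc ((-1) ^ a), ← hc₂, hb]
      push_cast
      congr 1 <;> ring
  · rw [← hr]
    congr 1 <;> ring
  -- Negating both `z₁` and `z₂` negates both `u` and `v`: the function is even in `u` and odd in
  -- `v`.
  · rw [← hr, ← Osp32.phiMod_neg_left m hτ (u := (z₁ + z₂) / 2) (v := -((z₁ - z₂) / 2))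
      (by rwa [← sub_eq_add_neg, e₂]) (by rwa [sub_neg_eq_add, e₁])]
    congr 1 <;> ring
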